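/- Let $1<p<\infty$. For a set $\Gamma$ and a weight $w:\Gamma\to(0,\infty)$, let $\mu_w(A)=\sum_{\gamma\in A}w(\gamma)$ for $A\subseteq\Gamma$, and let $\ell^{p,\infty}(\Gamma,w)$ be the real vector space of all functions $f:\Gamma\to\mathbb{R}$ with $$\|f\|=\sup_{c>0}c\,\bigl(\mu_w\{\gamma : |f(\gamma)|>c\}\bigr)^{1/p}<\infty ,$$ with the topology of the quasi-norm $\|\cdot\|$. Write $\ell^{p,\infty}(\Gamma)$ for $\ell^{p,\infty}(\Gamma,1)$. For a sequence $(\Pi_n)_{n=0}^\infty$ of pairwise disjoint sets, let $E(\Pi_n)=\ell^{p,\infty}(\bigcup_{n\ge 0}\Pi_n,w)$ with $w(\gamma)=2^n$ for $\gamma\in\Pi_n$. For a set $\Pi$, let $F(\Pi)=\ell^{p,\infty}(\Pi\times\{1,2,3,\dots\},w)$ with $w(\gamma,n)=2^{-n}$. Two spaces are called isomorphic if they are linearly homeomorphic. Theorem. Let $\Gamma$ be an uncountable set and let $w:\Gamma\to(0,\infty)$ be any function. Then $\ell^{p,\infty}(\Gamma,w)$ is isomorphic to a space of at least one of the following types: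 1. $\ell^{p,\infty}(\Gamma)$; 2. $E(\Pi_n)$ for some sequence $(\Pi_n)_{n=0}^\infty$ of pairwise disjoint sets with $|\Pi_n|\le|\Pi_{n+1}|$ and $|\Pi_n|<\sup_m|\Pi_m|=|\Gamma|$ for all $n\ge 0$; 3. $F(\Gamma)$; 4. $\ell^{p,\infty}(\Gamma)\oplus F(\Pi)$ for some set $\Pi$ with $\aleph_0<|\Pi|<|\Gamma|$; 5. $E(\Pi_n)\oplus F(\Pi)$ for some sequence $(\Pi_n)_{n=0}^\infty$ as in (2) and some set $\Pi$ with $\aleph_0<|\Pi|<|\Gamma|$. -/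

import Mathlib

open Cardinal
open scoped ENNReal

universe u v

namespace AtomicWeakLp

noncomputable section

/-- The measure on the power set of `Γ` with point masses `w`: `μ(A) = ∑_{γ ∈ A} w(γ)`. -/
def mass {Γ : Type u} (w : Γ → ℝ) (A : Set Γ) : ℝ≥0∞ :=
  ∑' γ : A, ENNReal.ofReal (w γ)

/-- The weak `L^p` quasi-norm `‖f‖ = sup_{c > 0} c · μ{|f| > c}^{1/p}`, with values in `[0, ∞]`. -/
def weakNorm {Γ : Type u} (p : ℝ) (w : Γ → ℝ) (f : Γ → ℝ) : ℝ≥0∞ :=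
  ⨆ (c : ℝ) (_ : 0 < c), ENNReal.ofReal c * mass w {γ | c < |f γ|} ^ (1 / p)

theorem weakNorm_add_le {Γ : Type u} (p : ℝ) (hp : 1 < p) (w : Γ → ℝ) (f g : Γ → ℝ) :
    weakNorm p w (f + g) ≤ 2 * (weakNorm p w f + weakNorm p w g) := by
  have h0 : (0 : ℝ) ≤ 1 / p := by positivity
  have h1 : 1 / p ≤ 1 := by rw [div_le_one (by linarith)]; exact hp.le
  refine iSup₂_le fun c hc => ?_
  have hc2 : 0 < c / 2 := by positivity
  have hsub : {γ | c < |(f + g) γ|} ⊆ {γ | c / 2 < |f γ|} ∪ {γ | c / 2 < |g γ|} := by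
    intro γ hγ
    simp only [Set.mem_ofPred_eq, Pi.add_apply, Set.mem_union] at hγ ⊢
    by_contra! h
    have := abs_add_le (f γ) (g γ)
    linarith
  have hm : mass w {γ | c < |(f + g) γ|} ≤
      mass w {γ | c / 2 < |f γ|} + mass w {γ | c / 2 < |g γ|} :=
    (ENNReal.tsum_mono_subtype (fun γ => ENNReal.ofReal (w γ)) hsub).trans
      (ENNReal.tsum_union_le (fun γ => ENNReal.ofReal (w γ)) _ _)
  have hcc : ENNReal.ofReal c = 2 * ENNReal.ofReal (c / 2) := by
    rw [← ENNReal.ofReal_ofNat 2, ← ENNReal.ofReal_mul (by norm_num)]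
    congr 1
    ring
  calc ENNReal.ofReal c * mass w {γ | c < |(f + g) γ|} ^ (1 / p)
      ≤ ENNReal.ofReal c * (mass w {γ | c / 2 < |f γ|} ^ (1 / p)
          + mass w {γ | c / 2 < |g γ|} ^ (1 / p)) := by
        gcongr
        exact (ENNReal.rpow_le_rpow hm h0).trans (ENNReal.rpow_add_le_add_rpow _ _ h0 h1)
    _ = 2 * (ENNReal.ofReal (c / 2) * mass w {γ | c / 2 < |f γ|} ^ (1 / p)
          + ENNReal.ofReal (c / 2) * mass w {γ | c / 2 < |g γ|} ^ (1 / p)) := by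
        rw [hcc]; ring
    _ ≤ 2 * (weakNorm p w f + weakNorm p w g) := by
        gcongr
        · exact le_iSup₂ (f := fun (c : ℝ) (_ : 0 < c) =>
            ENNReal.ofReal c * mass w {γ | c < |f γ|} ^ (1 / p)) (c / 2) hc2
        · exact le_iSup₂ (f := fun (c : ℝ) (_ : 0 < c) =>
            ENNReal.ofReal c * mass w {γ | c < |g γ|} ^ (1 / p)) (c / 2) hc2

theorem weakNorm_zero {Γ : Type u} (p : ℝ) (hp : 1 < p) (w : Γ → ℝ) :
    weakNorm p w (0 : Γ → ℝ) = 0 := by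
  have hp' : 0 < p := by linarith
  simp only [weakNorm, ENNReal.iSup_eq_zero]
  intro c hc
  have : {γ : Γ | c < |(0 : Γ → ℝ) γ|} = ∅ := by
    ext γ; simp [hc.le]
  rw [this]
  simp [mass, hp']

theorem weakNorm_smul_le {Γ : Type u} (p : ℝ) (hp : 1 < p) (w : Γ → ℝ) (a : ℝ) (f : Γ → ℝ) :
    weakNorm p w (a • f) ≤ ENNReal.ofReal |a| * weakNorm p w f := by
  rcases eq_or_ne a 0 with rfl | ha
  · rw [zero_smul, weakNorm_zero p hp]; exact zero_le
  have ha' : 0 < |a| := abs_pos.mpr ha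
  refine iSup₂_le fun c hc => ?_
  have hset : {γ | c < |(a • f) γ|} = {γ | c / |a| < |f γ|} := by
    ext γ
    simp only [Set.mem_ofPred_eq, Pi.smul_apply, smul_eq_mul, abs_mul]
    rw [div_lt_iff₀ ha', mul_comm]
  have hc' : ENNReal.ofReal c = ENNReal.ofReal |a| * ENNReal.ofReal (c / |a|) := by
    rw [← ENNReal.ofReal_mul ha'.le]
    congr 1
    field_simp
  rw [hset, hc', mul_assoc]
  gcongr
  exact le_iSup₂ (f := fun (c : ℝ) (_ : 0 < c) =>
    ENNReal.ofReal c * mass w {γ | c < |f γ|} ^ (1 / p)) (c / |a|) (by positivity)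

/-- The vector space of all `f : Γ → ℝ` with finite weak `L^p` quasi-norm. -/
def weakLpSubmodule {Γ : Type u} (p : ℝ) [hp : Fact (1 < p)] (w : Γ → ℝ) :
    Submodule ℝ (Γ → ℝ) where
  carrier := {f | weakNorm p w f < ∞}
  zero_mem' := by
    simp only [Set.mem_ofPred_eq, weakNorm_zero p hp.out]
    exact ENNReal.zero_lt_top
  add_mem' := fun {f g} hf hg =>
    (weakNorm_add_le p hp.out w f g).trans_lt
      (ENNReal.mul_lt_top ENNReal.ofNat_lt_top (ENNReal.add_lt_top.mpr ⟨hf, hg⟩))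
  smul_mem' := fun a f hf =>
    (weakNorm_smul_le p hp.out w a f).trans_lt (ENNReal.mul_lt_top ENNReal.ofReal_lt_top hf)

/-- The weak `L^p` space `ℓ^{p,∞}(Γ, w)`. It is a type of its own so that it carries the
quasi-norm topology and not the topology of pointwise convergence. -/
def WeakLp {Γ : Type u} (p : ℝ) [Fact (1 < p)] (w : Γ → ℝ) : Type u :=
  weakLpSubmodule p w

instance {Γ : Type u} (p : ℝ) [Fact (1 < p)] (w : Γ → ℝ) : AddCommGroup (WeakLp p w) :=
  inferInstanceAs (AddCommGroup (weakLpSubmodule p w))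

instance {Γ : Type u} (p : ℝ) [Fact (1 < p)] (w : Γ → ℝ) : Module ℝ (WeakLp p w) :=
  inferInstanceAs (Module ℝ (weakLpSubmodule p w))

/-- The function underlying an element of `ℓ^{p,∞}(Γ, w)`. -/
def WeakLp.toFun {Γ : Type u} {p : ℝ} [Fact (1 < p)] {w : Γ → ℝ} (f : WeakLp p w) : Γ → ℝ :=
  f.1

/-- The topology of the quasi-norm: `U` is open if and only if it contains, with each of its
points `f`, some ball `{g : ‖g - f‖ < ε}` with `ε > 0`. -/
instance {Γ : Type u} (p : ℝ) [Fact (1 < p)] (w : Γ → ℝ) : TopologicalSpace (WeakLp p w) where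
  IsOpen U := ∀ f ∈ U, ∃ ε : ℝ≥0∞, 0 < ε ∧
    ∀ g : WeakLp p w, weakNorm p w (g - f).toFun < ε → g ∈ U
  isOpen_univ := fun _ _ => ⟨1, one_pos, fun _ _ => Set.mem_univ _⟩
  isOpen_inter := by
    intro U V hU hV f hf
    obtain ⟨ε, hε, h⟩ := hU f hf.1
    obtain ⟨δ, hδ, k⟩ := hV f hf.2
    exact ⟨min ε δ, lt_min hε hδ, fun g hg =>
      ⟨h g (hg.trans_le (min_le_left _ _)), k g (hg.trans_le (min_le_right _ _))⟩⟩
  isOpen_sUnion := by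
    intro S hS f hf
    obtain ⟨U, hU, hfU⟩ := hf
    obtain ⟨ε, hε, h⟩ := hS U hU f hfU
    exact ⟨ε, hε, fun g hg => ⟨U, hU, h g hg⟩⟩

/-- `ℓ^{p,∞}(Γ)`: all atoms have mass `1`. -/
abbrev L (p : ℝ) [Fact (1 < p)] (Γ : Type u) : Type u :=
  WeakLp p (fun _ : Γ => (1 : ℝ))

/-- `E(Π_n)`: the atoms are the points of the disjoint union of the sets `Π_n`, `n ≥ 0`, and
those of `Π_n` have mass `2^n`. -/
abbrev E (p : ℝ) [Fact (1 < p)] (P : ℕ → Type u) : Type u :=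
  WeakLp p (fun x : (Σ n : ℕ, P n) => (2 : ℝ) ^ x.1)

/-- `F(Γ)`: the atoms are the points `(γ, n)` of `Γ × {1, 2, …}`, of mass `2^{-n}`. -/
abbrev F (p : ℝ) [Fact (1 < p)] (Γ : Type u) : Type u :=
  WeakLp p (fun x : Γ × ℕ+ => ((2 : ℝ) ^ (x.2 : ℕ))⁻¹)

/-- Two topological vector spaces over `ℝ` are isomorphic, i.e. linearly homeomorphic. -/
def Isomorphic (X : Type u) (Y : Type v) [AddCommGroup X] [Module ℝ X] [TopologicalSpace X]
    [AddCommGroup Y] [Module ℝ Y] [TopologicalSpace Y] : Prop :=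
  Nonempty (X ≃L[ℝ] Y)

/-- The sets `Π_n` have non-decreasing cardinalities, with `|Π_n| < sup_m |Π_m| = |Γ|`
for all `n`. -/
def Admissible (Γ : Type u) (P : ℕ → Type u) : Prop :=
  (∀ n, #(P n) ≤ #(P (n + 1))) ∧ (∀ n, #(P n) < ⨆ m, #(P m)) ∧ ⨆ m, #(P m) = #Γ

end

end AtomicWeakLp

/-! Pełczyński decomposition with an auxiliary space. Let X be the given space and Z the same space
with every atom repeated ℕ times, so that X ⊕ Z ≅ Z. If Y ⊕ Y ≅ Y, Y is complemented in X and Z is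
complemented in Y, then X ≅ Y (`isomorphic_of_retract`). Everything reduces to producing
complemented copies.

There are two sources. An atom may be replaced by a block of finitely many equal atoms of the same
total mass: functions constant on blocks are complemented by averaging, which is bounded because for
p > 1 weak L^p has an equivalent norm (`retract_of_blocks`). So if every atom of a space occurs
infinitely often up to a factor 2 (`Ample`), suitable small atoms can be assembled into prescribed
larger ones (`retract_of_ample`). Secondly, a countable set of atoms, however small, embeds
complementably into any nonzero ample space: stack rapidly growing dilations of its truncations, so
that all masses are at least 1, and project by an ultrafilter limit (`retract_stack`,
`retract_of_countable`).

For uncountable sets, only countably many atoms lie in dyadic scales with finitely many atoms, so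
discarding them costs no cardinality. Hence only the cardinalities of the sets {w ≤ c} matter. Those
for c → 0 eventually stabilise and decide the F-summand; those for c → ∞ decide between L and E. -/

namespace AtomicWeakLp

/-! ### The weak quasi-norm and the equivalent norm, tested on finite sets -/

noncomputable section

open Filter Topology

variable {p : ℝ} {Γ : Type*}

/-- `f` has weak `L^p` quasi-norm at most `K`, expressed through finite sets of atoms. -/
def WBound (p : ℝ) (w : Γ → ℝ) (f : Γ → ℝ) (K : ℝ) : Prop :=
  ∀ c : ℝ, 0 < c → ∀ A : Finset Γ, (∀ γ ∈ A, c < |f γ|) → c ^ p * ∑ γ ∈ A, w γ ≤ K ^ p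

/-- The equivalent Banach norm of weak `L^p`, for `p > 1`, is at most `K`. -/
def SBound (p : ℝ) (w : Γ → ℝ) (f : Γ → ℝ) (K : ℝ) : Prop :=
  ∀ A : Finset Γ, ∑ γ ∈ A, w γ * |f γ| ≤ K * (∑ γ ∈ A, w γ) ^ (1 - 1 / p)

theorem sum_le_mass (w : Γ → ℝ) (hw : ∀ γ, 0 ≤ w γ) (A : Finset Γ) (B : Set Γ)
    (h : ∀ γ ∈ A, γ ∈ B) : ENNReal.ofReal (∑ γ ∈ A, w γ) ≤ mass w B := by
  have h1 : mass w (A : Set Γ) = ENNReal.ofReal (∑ γ ∈ A, w γ) := by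
    rw [mass, ENNReal.ofReal_sum_of_nonneg (fun γ _ => hw γ)]
    exact Finset.tsum_subtype A (fun γ => ENNReal.ofReal (w γ))
  rw [← h1]
  exact ENNReal.tsum_mono_subtype (fun γ => ENNReal.ofReal (w γ)) h

theorem mass_le_of_finset (w : Γ → ℝ) (hw : ∀ γ, 0 ≤ w γ) (B : Set Γ) (M : ℝ≥0∞)
    (h : ∀ A : Finset Γ, (∀ γ ∈ A, γ ∈ B) → ENNReal.ofReal (∑ γ ∈ A, w γ) ≤ M) :
    mass w B ≤ M := by
  classical
  rw [mass, ENNReal.tsum_eq_iSup_sum]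
  refine iSup_le fun s => ?_
  have := h (s.map (Function.Embedding.subtype _)) (by
    intro γ hγ
    simp only [Finset.mem_map, Function.Embedding.subtype_apply] at hγ
    obtain ⟨x, _, rfl⟩ := hγ
    exact x.2)
  rw [Finset.sum_map, ENNReal.ofReal_sum_of_nonneg (fun γ _ => hw _)] at this
  exact this

/-- A sum of nonnegative terms is the supremum of its finite subsums, so extended-real estimates can
be traded for real ones. -/
theorem weakNorm_le_iff (hp1 : 1 < p) {w : Γ → ℝ} (hw : ∀ γ, 0 < w γ) (f : Γ → ℝ) {K : ℝ} (hK : 0 ≤ K) :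
    weakNorm p w f ≤ ENNReal.ofReal K ↔ WBound p w f K := by
  have hp0 : 0 < p := by linarith
  have key : ∀ c : ℝ, 0 < c → ∀ m : ℝ≥0∞, (ENNReal.ofReal c * m ^ (1 / p) ≤ ENNReal.ofReal K ↔
      m ≤ ENNReal.ofReal (K ^ p / c ^ p)) := by
    intro c hc m
    rw [mul_comm, ← ENNReal.le_div_iff_mul_le (Or.inl (by simpa using hc)) (Or.inl (by simp)),
      one_div, ENNReal.rpow_inv_le_iff hp0, ← ENNReal.ofReal_div_of_pos hc,
      ENNReal.ofReal_rpow_of_nonneg (by positivity) hp0.le, Real.div_rpow hK hc.le]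
  constructor
  · intro h c hc A hA
    have h1 := (key c hc _).1 ((le_iSup₂ (f := fun (c : ℝ) (_ : 0 < c) =>
      ENNReal.ofReal c * mass w {γ | c < |f γ|} ^ (1 / p)) c hc).trans h)
    have h2 := (sum_le_mass w (fun γ => (hw γ).le) A _ hA).trans h1
    rw [ENNReal.ofReal_le_ofReal_iff (by positivity)] at h2
    rw [mul_comm]
    exact (le_div_iff₀ (by positivity)).1 h2
  · intro h
    refine iSup₂_le fun c hc => (key c hc _).2 ?_
    refine mass_le_of_finset w (fun γ => (hw γ).le) _ _ fun A hA => ?_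
    refine ENNReal.ofReal_le_ofReal ?_
    rw [le_div_iff₀ (by positivity), mul_comm]
    exact h c hc A hA

theorem WBound.of_le {w f : Γ → ℝ} {C K : ℝ} (hp1 : 1 < p) (hC : 1 ≤ C) (hK : 0 ≤ K)
    (h : ∀ c : ℝ, 0 < c → ∀ A : Finset Γ, (∀ γ ∈ A, c < |f γ|) →
      c ^ p * ∑ γ ∈ A, w γ ≤ C * K ^ p) : WBound p w f (C * K) := by
  intro c hc A hA
  refine (h c hc A hA).trans ?_
  rw [Real.mul_rpow (by linarith) hK]
  gcongr
  exact Real.self_le_rpow_of_one_le hC hp1.le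

/-- On a set of mass M where |f| > c, the integral is at least cM; divide by M^(1 - 1/p). -/
theorem SBound.wbound {w f : Γ → ℝ} (hw : ∀ γ, 0 < w γ) {K : ℝ} (hK : 0 ≤ K) (hp1 : 1 < p)
    (h : SBound p w f K) : WBound p w f K := by
  intro c hc A hA
  have hp0 : 0 < p := by linarith
  rcases A.eq_empty_or_nonempty with rfl | hne
  · simp; positivity
  have hM : 0 < ∑ γ ∈ A, w γ := Finset.sum_pos (fun γ _ => hw γ) hne
  set M := ∑ γ ∈ A, w γ with hMdef
  have h1 : c * M ≤ K * M ^ (1 - 1 / p) := by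
    refine le_trans ?_ (h A)
    rw [hMdef, Finset.mul_sum]
    refine Finset.sum_le_sum fun γ hγ => ?_
    rw [mul_comm]
    exact mul_le_mul_of_nonneg_left (hA γ hγ).le (hw γ).le
  have h2 : c * M ^ (1 / p) ≤ K := by
    have h3 : M = M ^ (1 / p) * M ^ (1 - 1 / p) := by
      rw [← Real.rpow_add hM]; simp
    have h4 : 0 < M ^ (1 - 1 / p) := by positivity
    refine le_of_mul_le_mul_right ?_ h4
    rw [mul_assoc, ← h3]
    exact h1
  calc c ^ p * M = (c * M ^ (1 / p)) ^ p := by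
        rw [Real.mul_rpow hc.le (by positivity), ← Real.rpow_mul hM.le]
        simp [hp0.ne']
    _ ≤ K ^ p := by gcongr

/-- The constant in the comparison of the two bounds. -/
def sconst (p : ℝ) : ℝ := 1 + (1 - (2 : ℝ) ^ (1 - p))⁻¹

theorem two_rpow_lt_one (hp1 : 1 < p) : (2 : ℝ) ^ (1 - p) < 1 :=
  Real.rpow_lt_one_of_one_lt_of_neg (by norm_num) (by linarith)

theorem one_le_sconst (hp1 : 1 < p) : 1 ≤ sconst p := by
  have := two_rpow_lt_one hp1
  have : 0 < 1 - (2 : ℝ) ^ (1 - p) := by linarith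
  rw [sconst]
  have := inv_pos.2 this
  linarith

theorem le_dyadic_sum {a x : ℝ} (ha : 0 < a) (N : ℕ) (hx : x ≤ 2 ^ N * a) :
    x ≤ a + ∑ k ∈ Finset.range N, if 2 ^ k * a < x then 2 ^ k * a else 0 := by
  induction N with
  | zero => simpa using hx
  | succ N ih =>
    rw [Finset.sum_range_succ]
    by_cases h : 2 ^ N * a < x
    · rw [if_pos h]
      have h1 : ∑ k ∈ Finset.range N, (if 2 ^ k * a < x then 2 ^ k * a else 0)
          = ∑ k ∈ Finset.range N, 2 ^ k * a := by
        refine Finset.sum_congr rfl fun k hk => if_pos (lt_of_le_of_lt ?_ h)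
        have := (Finset.mem_range.1 hk).le
        gcongr
        norm_num
      have h2 : a + ∑ k ∈ Finset.range N, 2 ^ k * a = 2 ^ N * a := by
        rw [← Finset.sum_mul, geom_sum_eq (by norm_num)]
        ring
      rw [h1]
      rw [pow_succ] at hx
      linarith
    · rw [if_neg h, add_zero]
      exact ih (not_lt.1 h)

/-- Layer-cake estimate over the thresholds 2^k a: the part of A above the k-th has mass at most
2^(-kp) M, so it contributes at most aM · 2^(k(1-p)), a convergent geometric series since p > 1. -/
theorem WBound.sbound {w f : Γ → ℝ} (hw : ∀ γ, 0 < w γ) {K : ℝ} (hK : 0 < K) (hp1 : 1 < p)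
    (h : WBound p w f K) : SBound p w f (sconst p * K) := by
  intro A
  have hp0 : 0 < p := by linarith
  rcases A.eq_empty_or_nonempty with rfl | hne
  · have : 1 - 1 / p ≠ 0 := by
      have : 1 / p < 1 := by rw [div_lt_one hp0]; exact hp1
      linarith
    simp only [Finset.sum_empty]
    rw [Real.zero_rpow this, mul_zero]
  have hM : 0 < ∑ γ ∈ A, w γ := Finset.sum_pos (fun γ _ => hw γ) hne
  set M := ∑ γ ∈ A, w γ with hMdef
  -- The height at which the weak bound for the superlevel set equals the full mass M.
  set a := K * M ^ (-(1 / p)) with hadef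
  have ha : 0 < a := by positivity
  have hKa : K = a * M ^ (1 / p) := by
    rw [hadef, mul_assoc, ← Real.rpow_add hM]; simp
  have haM : a * M = K * M ^ (1 - 1 / p) := by
    rw [hadef, mul_assoc]
    nth_rewrite 2 [← Real.rpow_one M]
    rw [← Real.rpow_add hM]
    congr 2; ring
  obtain ⟨N, hN⟩ : ∃ N : ℕ, ∀ γ ∈ A, |f γ| ≤ 2 ^ N * a := by
    obtain ⟨N, hN⟩ := pow_unbounded_of_one_lt ((∑ γ ∈ A, |f γ|) / a) (one_lt_two (α := ℝ))
    refine ⟨N, fun γ hγ => ?_⟩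
    rw [div_lt_iff₀ ha] at hN
    exact (Finset.single_le_sum (f := fun γ => |f γ|) (fun γ _ => abs_nonneg _) hγ).trans hN.le
  have hlev : ∀ k : ℕ, ∑ γ ∈ A, w γ * (if 2 ^ k * a < |f γ| then 2 ^ k * a else 0) ≤
      a * M * ((2 : ℝ) ^ (1 - p)) ^ k := by
    intro k
    have hc : 0 < 2 ^ k * a := by positivity
    have h1 := h (2 ^ k * a) hc (A.filter fun γ => 2 ^ k * a < |f γ|)
      (fun γ hγ => (Finset.mem_filter.1 hγ).2)
    have h2 : ∑ γ ∈ A, w γ * (if 2 ^ k * a < |f γ| then 2 ^ k * a else 0) =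
        2 ^ k * a * ∑ γ ∈ A.filter (fun γ => 2 ^ k * a < |f γ|), w γ := by
      rw [Finset.sum_filter, Finset.mul_sum]
      refine Finset.sum_congr rfl fun γ _ => ?_
      split_ifs <;> ring
    rw [h2]
    set m := ∑ γ ∈ A.filter (fun γ => 2 ^ k * a < |f γ|), w γ
    have h3 : K ^ p = a ^ p * M := by
      rw [hKa, Real.mul_rpow ha.le (by positivity), ← Real.rpow_mul hM.le]
      simp [hp0.ne']
    rw [h3, Real.mul_rpow (by positivity) ha.le] at h1
    have h4 : ((2 : ℝ) ^ k) ^ p * m ≤ M := by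
      have : 0 < a ^ p := by positivity
      refine le_of_mul_le_mul_left ?_ this
      linarith
    have h5 : ((2 : ℝ) ^ (1 - p)) ^ k * ((2 : ℝ) ^ k) ^ p = 2 ^ k := by
      rw [← Real.rpow_natCast, ← Real.rpow_mul (by norm_num), ← Real.rpow_natCast 2 k,
        ← Real.rpow_mul (by norm_num), ← Real.rpow_add (by norm_num)]
      congr 1; ring
    calc 2 ^ k * a * m = a * ((2 : ℝ) ^ (1 - p)) ^ k * (((2 : ℝ) ^ k) ^ p * m) := by
          nth_rewrite 1 [← h5]; ring
      _ ≤ a * ((2 : ℝ) ^ (1 - p)) ^ k * M := by gcongr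
      _ = _ := by ring
  have hgeom : ∑ k ∈ Finset.range N, ((2 : ℝ) ^ (1 - p)) ^ k ≤ (1 - (2 : ℝ) ^ (1 - p))⁻¹ := by
    have h0 : (0 : ℝ) ≤ 2 ^ (1 - p) := by positivity
    rw [← tsum_geometric_of_lt_one h0 (two_rpow_lt_one hp1)]
    exact (summable_geometric_of_lt_one h0 (two_rpow_lt_one hp1)).sum_le_tsum _
      (fun k _ => by positivity)
  calc ∑ γ ∈ A, w γ * |f γ|
      ≤ ∑ γ ∈ A, w γ * (a + ∑ k ∈ Finset.range N,
          if 2 ^ k * a < |f γ| then 2 ^ k * a else 0) := by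
        refine Finset.sum_le_sum fun γ hγ => ?_
        exact mul_le_mul_of_nonneg_left (le_dyadic_sum ha N (hN γ hγ)) (hw γ).le
    _ = a * M + ∑ k ∈ Finset.range N, ∑ γ ∈ A,
          w γ * (if 2 ^ k * a < |f γ| then 2 ^ k * a else 0) := by
        simp only [mul_add, Finset.sum_add_distrib, Finset.mul_sum]
        rw [Finset.sum_comm, hMdef, Finset.mul_sum]
        simp only [mul_comm a]
    _ ≤ a * M + ∑ k ∈ Finset.range N, a * M * ((2 : ℝ) ^ (1 - p)) ^ k := by
        gcongr with k hk
        exact hlev k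
    _ ≤ a * M + a * M * (1 - (2 : ℝ) ^ (1 - p))⁻¹ := by
        rw [← Finset.mul_sum]
        gcongr
    _ = sconst p * K * M ^ (1 - 1 / p) := by
        rw [mul_assoc (sconst p), ← haM]
        simp only [sconst]
        ring

end

/-! ### The quasi-norm topology and bounded operators -/

noncomputable section

open Filter Topology

section Topological

variable {p : ℝ} [hp : Fact (1 < p)] {Γ : Type u} {Δ : Type v}

theorem mem_nhds_iff' {w : Γ → ℝ} {f : WeakLp p w} {s : Set (WeakLp p w)} :
    s ∈ 𝓝 f ↔ ∃ ε : ℝ≥0∞, 0 < ε ∧ ∀ g : WeakLp p w, weakNorm p w (g - f).toFun < ε → g ∈ s := by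
  constructor
  · intro h
    obtain ⟨U, hUs, hU, hf⟩ := mem_nhds_iff.1 h
    obtain ⟨ε, hε, hb⟩ := hU f hf
    exact ⟨ε, hε, fun g hg => hUs (hb g hg)⟩
  · rintro ⟨ε, hε, hb⟩
    refine mem_nhds_iff.2 ⟨{g | ∃ δ : ℝ≥0∞, 0 < δ ∧
      ∀ h : WeakLp p w, weakNorm p w (h - g).toFun < δ → h ∈ s}, ?_, ?_, ⟨ε, hε, hb⟩⟩
    · rintro g ⟨δ, hδ, hg⟩
      refine hg g ?_
      rw [sub_self]
      exact (weakNorm_zero p hp.out w).trans_lt hδ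
    · rintro g ⟨δ, hδ, hg⟩
      -- The quasi-triangle constant is 2, and 2(δ/4 + δ/4) = δ.
      refine ⟨δ / 4, ENNReal.div_pos hδ.ne' (by simp), fun h hh =>
        ⟨δ / 4, ENNReal.div_pos hδ.ne' (by simp), fun k hk => hg k ?_⟩⟩
      have h1 : (k - g).toFun = (k - h).toFun + (h - g).toFun := by
        rw [← sub_add_sub_cancel k h g]; rfl
      rw [h1]
      refine (weakNorm_add_le p hp.out w _ _).trans_lt ?_
      calc 2 * (weakNorm p w (k - h).toFun + weakNorm p w (h - g).toFun)
          < 2 * (δ / 4 + δ / 4) :=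
            ENNReal.mul_lt_mul_right (by simp) (by simp) (ENNReal.add_lt_add hk hh)
        _ = 4 * (δ / 4) := by ring
        _ = δ := ENNReal.mul_div_cancel (by simp) (by simp)

/-- The linear map to the underlying functions. -/
def toFunₗ (p : ℝ) [Fact (1 < p)] (w : Γ → ℝ) : WeakLp p w →ₗ[ℝ] (Γ → ℝ) where
  toFun f := f.toFun
  map_add' _ _ := rfl
  map_smul' _ _ := rfl

/-- The element of the weak `L^p` space with a given underlying function. -/
def WeakLp.mk {w : Γ → ℝ} (f : Γ → ℝ) (hf : weakNorm p w f < ∞) : WeakLp p w := ⟨f, hf⟩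

/-- A continuous linear map between weak `L^p` spaces from a bounded map into functions. -/
def clmOfLe {w : Γ → ℝ} {v : Δ → ℝ} (T : WeakLp p w →ₗ[ℝ] (Δ → ℝ)) (C : ℝ)
    (h : ∀ f, weakNorm p v (T f) ≤ ENNReal.ofReal C * weakNorm p w f.toFun) :
    WeakLp p w →L[ℝ] WeakLp p v where
  toFun f := .mk (T f) <| (h f).trans_lt (ENNReal.mul_lt_top ENNReal.ofReal_lt_top f.2)
  map_add' f g := Subtype.ext (T.map_add f g)
  map_smul' a f := Subtype.ext (T.map_smul a f)
  cont := by
    refine continuous_iff_continuousAt.2 fun f s hs => ?_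
    obtain ⟨ε, hε, hb⟩ := mem_nhds_iff'.1 hs
    refine mem_nhds_iff'.2 ⟨ε / (ENNReal.ofReal C + 1), ENNReal.div_pos hε.ne' (by simp),
      fun g hg => hb _ ?_⟩
    have h1 := h (g - f)
    rw [T.map_sub] at h1
    refine h1.trans_lt ?_
    calc ENNReal.ofReal C * weakNorm p w (g - f).toFun
        ≤ (ENNReal.ofReal C + 1) * weakNorm p w (g - f).toFun := by gcongr; exact le_self_add
      _ < (ENNReal.ofReal C + 1) * (ε / (ENNReal.ofReal C + 1)) :=
        ENNReal.mul_lt_mul_right (by simp) (by simp) hg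
      _ = ε := ENNReal.mul_div_cancel (by simp) (by simp)

/-- The hypothesis speaks only of K > 0, so it is applied to K slightly above the quasi-norm, which
may vanish, and K then decreases to it. -/
theorem weakNorm_le_of_wbound {w : Γ → ℝ} {v : Δ → ℝ} (hw : ∀ γ, 0 < w γ) (hv : ∀ δ, 0 < v δ)
    {C : ℝ} (hC : 0 ≤ C) {f : Γ → ℝ} {g : Δ → ℝ} (hf : weakNorm p w f < ∞)
    (h : ∀ K, 0 < K → WBound p w f K → WBound p v g (C * K)) :
    weakNorm p v g ≤ ENNReal.ofReal C * weakNorm p w f := by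
  have h1 : ∀ K : ℝ, weakNorm p w f < ENNReal.ofReal K →
      weakNorm p v g ≤ ENNReal.ofReal C * ENNReal.ofReal K := by
    intro K hK
    have hK0 : 0 < K := by
      by_contra h0
      rw [ENNReal.ofReal_of_nonpos (not_lt.1 h0)] at hK
      exact not_lt_zero hK
    rw [← ENNReal.ofReal_mul hC, weakNorm_le_iff hp.out hv _ (by positivity)]
    exact h K hK0 ((weakNorm_le_iff hp.out hw _ hK0.le).1 hK.le)
  set a := (weakNorm p w f).toReal with ha
  have ha' : weakNorm p w f = ENNReal.ofReal a := (ENNReal.ofReal_toReal hf.ne).symm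
  have ha0 : 0 ≤ a := ENNReal.toReal_nonneg
  rw [ha', ← ENNReal.ofReal_mul hC]
  refine ENNReal.le_of_forall_pos_le_add fun ε hε _ => ?_
  have h2 := h1 (a + ε / (C + 1)) (by
    rw [ha']
    exact ENNReal.ofReal_lt_ofReal_iff'.2 ⟨lt_add_of_pos_right _ (by positivity), by positivity⟩)
  refine h2.trans ?_
  rw [← ENNReal.ofReal_mul hC, ← ENNReal.ofReal_coe_nnreal,
    ← ENNReal.ofReal_add (by positivity) (by positivity)]
  refine ENNReal.ofReal_le_ofReal ?_
  have : C * ((ε : ℝ) / (C + 1)) ≤ ε := by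
    rw [mul_div_assoc', div_le_iff₀ (by positivity)]
    nlinarith [ε.2]
  linarith

/-- A continuous linear map between weak `L^p` spaces from a map that preserves bounds. -/
def clmOfBound {w : Γ → ℝ} {v : Δ → ℝ} (hw : ∀ γ, 0 < w γ) (hv : ∀ δ, 0 < v δ)
    (T : WeakLp p w →ₗ[ℝ] (Δ → ℝ)) (C : ℝ) (hC : 0 ≤ C)
    (h : ∀ f : WeakLp p w, ∀ K, 0 < K → WBound p w f.toFun K → WBound p v (T f) (C * K)) :
    WeakLp p w →L[ℝ] WeakLp p v :=
  clmOfLe T C fun f => weakNorm_le_of_wbound hw hv hC f.2 (h f)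

theorem WeakLp.ext {w : Γ → ℝ} {f g : WeakLp p w} (h : ∀ γ, f.toFun γ = g.toFun γ) : f = g :=
  Subtype.ext (funext h)

theorem clmOfBound_toFun {w : Γ → ℝ} {v : Δ → ℝ} (hw : ∀ γ, 0 < w γ) (hv : ∀ δ, 0 < v δ)
    (T : WeakLp p w →ₗ[ℝ] (Δ → ℝ)) (C : ℝ) (hC : 0 ≤ C)
    (h : ∀ f : WeakLp p w, ∀ K, 0 < K → WBound p w f.toFun K → WBound p v (T f) (C * K))
    (f : WeakLp p w) : (clmOfBound hw hv T C hC h f).toFun = T f := rfl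

theorem exists_wbound {w : Γ → ℝ} (hw : ∀ γ, 0 < w γ) (f : WeakLp p w) :
    ∃ K, 0 < K ∧ WBound p w f.toFun K := by
  have hf : weakNorm p w f.toFun < ∞ := f.2
  refine ⟨(weakNorm p w f.toFun).toReal + 1, by positivity, ?_⟩
  rw [← weakNorm_le_iff hp.out hw _ (by positivity)]
  rw [ENNReal.ofReal_add (by positivity) (by norm_num), ENNReal.ofReal_toReal hf.ne]
  exact le_self_add

instance (w : Γ → ℝ) : IsTopologicalAddGroup (WeakLp p w) where
  continuous_add := by
    rw [continuous_iff_continuousAt]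
    rintro ⟨f, g⟩ s hs
    obtain ⟨ε, hε, hb⟩ := mem_nhds_iff'.1 hs
    have hε4 : 0 < ε / 4 := ENNReal.div_pos hε.ne' (by simp)
    rw [Filter.mem_map, nhds_prod_eq]
    refine Filter.mem_of_superset (Filter.prod_mem_prod
      (mem_nhds_iff'.2 ⟨ε / 4, hε4, fun g hg => hg⟩) (mem_nhds_iff'.2 ⟨ε / 4, hε4, fun g hg => hg⟩)) ?_
    rintro ⟨f', g'⟩ ⟨hf', hg'⟩
    refine hb _ ?_
    have h1 : (f' + g' - (f + g)).toFun = (f' - f).toFun + (g' - g).toFun := by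
      rw [add_sub_add_comm]; rfl
    change weakNorm p w (f' + g' - (f + g)).toFun < ε
    rw [h1]
    refine (weakNorm_add_le p hp.out w _ _).trans_lt ?_
    calc 2 * (weakNorm p w (f' - f).toFun + weakNorm p w (g' - g).toFun)
        < 2 * (ε / 4 + ε / 4) :=
          ENNReal.mul_lt_mul_right (by simp) (by simp) (ENNReal.add_lt_add hf' hg')
      _ = 4 * (ε / 4) := by ring
      _ = ε := ENNReal.mul_div_cancel (by simp) (by simp)
  continuous_neg :=
    (clmOfLe (-toFunₗ p w) 1 (fun f => by
      have := weakNorm_smul_le p hp.out w (-1) f.toFun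
      rw [neg_one_smul, abs_neg, abs_one] at this
      exact this)).continuous

end Topological

/-! ### Complemented subspaces and the decomposition method -/

section Retract

/-- `X` is isomorphic to a complemented subspace of `Y`. -/
def Retract (X : Type*) (Y : Type*) [AddCommGroup X] [Module ℝ X] [TopologicalSpace X]
    [AddCommGroup Y] [Module ℝ Y] [TopologicalSpace Y] : Prop :=
  ∃ (i : X →L[ℝ] Y) (r : Y →L[ℝ] X), ∀ x, r (i x) = x

variable {X Y Z X' Y' : Type*}
  [AddCommGroup X] [Module ℝ X] [TopologicalSpace X]
  [AddCommGroup Y] [Module ℝ Y] [TopologicalSpace Y]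
  [AddCommGroup Z] [Module ℝ Z] [TopologicalSpace Z]
  [AddCommGroup X'] [Module ℝ X'] [TopologicalSpace X']
  [AddCommGroup Y'] [Module ℝ Y'] [TopologicalSpace Y']

theorem Retract.trans (h : Retract X Y) (h' : Retract Y Z) : Retract X Z := by
  obtain ⟨i, r, hr⟩ := h
  obtain ⟨j, s, hs⟩ := h'
  exact ⟨j.comp i, r.comp s, fun x => by simp [hs, hr]⟩

theorem Retract.prod (h : Retract X Y) (h' : Retract X' Y') : Retract (X × X') (Y × Y') := by
  obtain ⟨i, r, hr⟩ := h
  obtain ⟨j, s, hs⟩ := h'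
  exact ⟨i.prodMap j, r.prodMap s, fun x => Prod.ext (hr x.1) (hs x.2)⟩

theorem Isomorphic.retract (h : Isomorphic X Y) : Retract X Y := by
  obtain ⟨e⟩ := h
  exact ⟨e, e.symm, fun x => by simp⟩

theorem Isomorphic.symm (h : Isomorphic X Y) : Isomorphic Y X := by
  obtain ⟨e⟩ := h
  exact ⟨e.symm⟩

theorem Isomorphic.trans (h : Isomorphic X Y) (h' : Isomorphic Y Z) : Isomorphic X Z := by
  obtain ⟨e⟩ := h
  obtain ⟨e'⟩ := h'
  exact ⟨e.trans e'⟩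

/-- A complemented subspace that absorbs `Z` makes the whole space absorb `Z`. -/
theorem Retract.absorb [IsTopologicalAddGroup Y] (h : Retract X Y) (hX : Isomorphic (Z × X) X) :
    Isomorphic (Z × Y) Y := by
  obtain ⟨i, r, hr⟩ := h
  obtain ⟨e⟩ := hX
  -- Y splits as X ⊕ ker r, and the summand X swallows Z.
  let d : Y ≃L[ℝ] X × r.ker := ContinuousLinearEquiv.equivOfRightInverse r i hr
  exact ⟨((ContinuousLinearEquiv.refl ℝ Z).prodCongr d).trans
    ((ContinuousLinearEquiv.prodAssoc ℝ Z X r.ker).symm.trans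
      ((e.prodCongr (.refl ℝ _)).trans d.symm))⟩

theorem Isomorphic.prod_comm : Isomorphic (X × Y) (Y × X) :=
  ⟨ContinuousLinearEquiv.prodComm ℝ X Y⟩

/-- Pełczyński's decomposition method. -/
theorem isomorphic_of_retract [IsTopologicalAddGroup X] [IsTopologicalAddGroup Y]
    (hY : Isomorphic (Y × Y) Y) (hZ : Isomorphic (X × Z) Z) (hYX : Retract Y X)
    (hZY : Retract Z Y) : Isomorphic X Y :=
  -- X ≅ Y ⊕ X because X contains Y, which absorbs Y; X ⊕ Y ≅ Y because Y contains Z, which absorbs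
  -- X.
  (hYX.absorb hY).symm.trans (Isomorphic.prod_comm.trans (hZY.absorb hZ))

theorem Isomorphic.prod_prod_comm (hX : Isomorphic (X × X) X) (hY : Isomorphic (Y × Y) Y) :
    Isomorphic ((X × Y) × X × Y) (X × Y) := by
  obtain ⟨e⟩ := hX
  obtain ⟨e'⟩ := hY
  exact ⟨(ContinuousLinearEquiv.prodProdProdComm ℝ X Y X Y).trans (e.prodCongr e')⟩

end Retract

end

/-! ### Operators induced by maps of atoms: composition, extension by zero, block averages -/

noncomputable section

variable {p : ℝ} {A : Type u} {B : Type v}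

/-- Superlevel sets of f ∘ π are preimages of those of f, and preimages increase mass by at most the
factor C. -/
theorem wbound_comp {w : A → ℝ} {v : B → ℝ} (hp1 : 1 < p)
    (π : A → B) {C : ℝ} (hC : 1 ≤ C)
    (h : ∀ b, ∀ S : Finset A, (∀ a ∈ S, π a = b) → ∑ a ∈ S, w a ≤ C * v b)
    {f : B → ℝ} {K : ℝ} (hK : 0 < K) (hf : WBound p v f K) : WBound p w (f ∘ π) (C * K) := by
  classical
  refine WBound.of_le hp1 hC hK.le fun c hc S hS => ?_
  have h1 := hf c hc (S.image π) (by
    intro b hb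
    obtain ⟨a, ha, rfl⟩ := Finset.mem_image.1 hb
    exact hS a ha)
  have h2 : ∑ a ∈ S, w a ≤ C * ∑ b ∈ S.image π, v b := by
    rw [← Finset.sum_fiberwise_of_maps_to (t := S.image π) (g := π)
      (fun a ha => Finset.mem_image_of_mem _ ha), Finset.mul_sum]
    exact Finset.sum_le_sum fun b _ => h b _ fun a ha => (Finset.mem_filter.1 ha).2
  calc c ^ p * ∑ a ∈ S, w a ≤ c ^ p * (C * ∑ b ∈ S.image π, v b) := by gcongr
    _ = C * (c ^ p * ∑ b ∈ S.image π, v b) := by ring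
    _ ≤ C * K ^ p := by gcongr

/-- Composition with a map whose fibres have bounded relative mass. -/
def compCLM (p : ℝ) [hp : Fact (1 < p)] {w : A → ℝ} {v : B → ℝ} (hw : ∀ a, 0 < w a)
    (hv : ∀ b, 0 < v b) (π : A → B) {C : ℝ} (hC : 1 ≤ C)
    (h : ∀ b, ∀ S : Finset A, (∀ a ∈ S, π a = b) → ∑ a ∈ S, w a ≤ C * v b) :
    WeakLp p v →L[ℝ] WeakLp p w :=
  clmOfBound hv hw ((LinearMap.funLeft ℝ ℝ π).comp (toFunₗ p v)) C (by linarith)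
    fun _ _ hK hf => wbound_comp hp.out π hC h hK hf

theorem compCLM_apply [hp : Fact (1 < p)] {w : A → ℝ} {v : B → ℝ} (hw : ∀ a, 0 < w a)
    (hv : ∀ b, 0 < v b) (π : A → B) {C : ℝ} (hC : 1 ≤ C)
    (h : ∀ b, ∀ S : Finset A, (∀ a ∈ S, π a = b) → ∑ a ∈ S, w a ≤ C * v b)
    (f : WeakLp p v) (a : A) : (compCLM p hw hv π hC h f).toFun a = f.toFun (π a) := rfl

theorem sum_le_of_injective {w : A → ℝ} {v : B → ℝ} (hv : ∀ b, 0 < v b)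
    {π : A → B} (hπ : Function.Injective π) {C : ℝ} (hC : 1 ≤ C)
    (h : ∀ a, w a ≤ C * v (π a)) (b : B) (S : Finset A) (hS : ∀ a ∈ S, π a = b) :
    ∑ a ∈ S, w a ≤ C * v b := by
  rcases S.eq_empty_or_nonempty with rfl | ⟨a, ha⟩
  · have := hv b
    simp only [Finset.sum_empty]; positivity
  · have : S = {a} := Finset.eq_singleton_iff_unique_mem.2
      ⟨ha, fun x hx => hπ ((hS x hx).trans (hS a ha).symm)⟩
    rw [this, Finset.sum_singleton, ← hS a ha]
    exact h a

theorem wbound_extend {w : A → ℝ} {v : B → ℝ} (hp1 : 1 < p)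
    {e : A → B} (he : Function.Injective e) {C : ℝ} (hC : 1 ≤ C) (h : ∀ a, v (e a) ≤ C * w a)
    {f : A → ℝ} {K : ℝ} (hK : 0 < K) (hf : WBound p w f K) :
    WBound p v (Function.extend e f 0) (C * K) := by
  classical
  refine WBound.of_le hp1 hC hK.le fun c hc S hS => ?_
  have hr : ∀ b ∈ S, b ∈ Set.range e := by
    intro b hb
    by_contra hn
    have := hS b hb
    rw [Function.extend_apply' _ _ _ (fun ⟨a, ha⟩ => hn ⟨a, ha⟩)] at this
    simp only [Pi.zero_apply, abs_zero] at this
    exact lt_asymm hc this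
  have h1 := hf c hc (S.preimage e he.injOn) (by
    intro a ha
    have := hS _ (Finset.mem_preimage.1 ha)
    rwa [he.extend_apply] at this)
  have h2 : ∑ b ∈ S, v b ≤ C * ∑ a ∈ S.preimage e he.injOn, w a := by
    rw [← Finset.sum_preimage e S he.injOn v (fun b hb hb' => absurd (hr b hb) hb'),
      Finset.mul_sum]
    exact Finset.sum_le_sum fun a _ => h a
  calc c ^ p * ∑ b ∈ S, v b ≤ c ^ p * (C * ∑ a ∈ S.preimage e he.injOn, w a) := by gcongr
    _ = C * (c ^ p * ∑ a ∈ S.preimage e he.injOn, w a) := by ring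
    _ ≤ C * K ^ p := by gcongr

/-- Extension by zero along an injective map. -/
def extendCLM (p : ℝ) [hp : Fact (1 < p)] {w : A → ℝ} {v : B → ℝ} (hw : ∀ a, 0 < w a)
    (hv : ∀ b, 0 < v b) {e : A → B} (he : Function.Injective e) {C : ℝ} (hC : 1 ≤ C)
    (h : ∀ a, v (e a) ≤ C * w a) : WeakLp p w →L[ℝ] WeakLp p v :=
  clmOfBound hw hv ((Function.ExtendByZero.linearMap ℝ e).comp (toFunₗ p w)) C (by linarith)
    fun _ _ hK hf => wbound_extend hp.out he hC h hK hf

theorem extendCLM_apply [hp : Fact (1 < p)] {w : A → ℝ} {v : B → ℝ} (hw : ∀ a, 0 < w a)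
    (hv : ∀ b, 0 < v b) {e : A → B} (he : Function.Injective e) {C : ℝ} (hC : 1 ≤ C)
    (h : ∀ a, v (e a) ≤ C * w a) (f : WeakLp p w) (a : A) :
    (extendCLM p hw hv he hC h f).toFun (e a) = f.toFun a :=
  he.extend_apply _ _ _

theorem extendCLM_apply_of_forall_ne [hp : Fact (1 < p)] {w : A → ℝ} {v : B → ℝ} (hw : ∀ a, 0 < w a)
    (hv : ∀ b, 0 < v b) {e : A → B} (he : Function.Injective e) {C : ℝ} (hC : 1 ≤ C)
    (h : ∀ a, v (e a) ≤ C * w a) (f : WeakLp p w) (b : B) (hb : ∀ a, e a ≠ b) :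
    (extendCLM p hw hv he hC h f).toFun b = 0 :=
  Function.extend_apply' _ _ _ fun ⟨a, ha⟩ => hb a ha

theorem isomorphic_of_equiv (p : ℝ) [hp : Fact (1 < p)] {w : A → ℝ} {v : B → ℝ}
    (hw : ∀ a, 0 < w a) (hv : ∀ b, 0 < v b)
    (e : A ≃ B) {C : ℝ} (hC : 1 ≤ C) (h : ∀ a, v (e a) ≤ C * w a) (h' : ∀ a, w a ≤ C * v (e a)) :
    Isomorphic (WeakLp p w) (WeakLp p v) :=
  ⟨ContinuousLinearEquiv.equivOfInverse
    (compCLM p hv hw e.symm hC (sum_le_of_injective hw e.symm.injective hC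
      (fun b => by simpa using h (e.symm b))))
    (compCLM p hw hv e hC (sum_le_of_injective hv e.injective hC h'))
    (fun f => WeakLp.ext fun a => by simp [compCLM_apply])
    (fun f => WeakLp.ext fun a => by simp [compCLM_apply])⟩

theorem retract_of_injective (p : ℝ) [hp : Fact (1 < p)] {w : A → ℝ} {v : B → ℝ}
    (hw : ∀ a, 0 < w a) (hv : ∀ b, 0 < v b)
    {e : A → B} (he : Function.Injective e) {C : ℝ} (hC : 1 ≤ C) (h : ∀ a, v (e a) ≤ C * w a)
    (h' : ∀ a, w a ≤ C * v (e a)) : Retract (WeakLp p w) (WeakLp p v) :=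
  ⟨extendCLM p hw hv he hC h, compCLM p hw hv e hC (sum_le_of_injective hv he hC h'),
    fun f => WeakLp.ext fun a => by rw [compCLM_apply, extendCLM_apply]⟩

theorem sum_elim_pos {w : A → ℝ} {v : B → ℝ} (hw : ∀ a, 0 < w a) (hv : ∀ b, 0 < v b)
    (x : A ⊕ B) : 0 < Sum.elim w v x := by
  rcases x with a | b
  exacts [hw a, hv b]

theorem isomorphic_sum (p : ℝ) [hp : Fact (1 < p)] {w : A → ℝ} {v : B → ℝ}
    (hw : ∀ a, 0 < w a) (hv : ∀ b, 0 < v b) :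
    Isomorphic (WeakLp p (Sum.elim w v)) (WeakLp p w × WeakLp p v) := by
  have hs := sum_elim_pos hw hv
  let r₁ : WeakLp p (Sum.elim w v) →L[ℝ] WeakLp p w := compCLM p hw hs Sum.inl le_rfl
    (sum_le_of_injective hs Sum.inl_injective le_rfl (fun a => by simp))
  let r₂ : WeakLp p (Sum.elim w v) →L[ℝ] WeakLp p v := compCLM p hv hs Sum.inr le_rfl
    (sum_le_of_injective hs Sum.inr_injective le_rfl (fun a => by simp))
  let i₁ : WeakLp p w →L[ℝ] WeakLp p (Sum.elim w v) :=
    extendCLM p hw hs Sum.inl_injective le_rfl (fun a => by simp)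
  let i₂ : WeakLp p v →L[ℝ] WeakLp p (Sum.elim w v) :=
    extendCLM p hv hs Sum.inr_injective le_rfl (fun a => by simp)
  have h11 : ∀ f a, (i₁ f).toFun (Sum.inl a) = f.toFun a := fun f a => extendCLM_apply _ _ _ _ _ _ _
  have h22 : ∀ f a, (i₂ f).toFun (Sum.inr a) = f.toFun a := fun f a => extendCLM_apply _ _ _ _ _ _ _
  have h12 : ∀ f a, (i₁ f).toFun (Sum.inr a) = 0 := fun f a =>
    extendCLM_apply_of_forall_ne _ _ _ _ _ _ _ (by simp)
  have h21 : ∀ f a, (i₂ f).toFun (Sum.inl a) = 0 := fun f a =>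
    extendCLM_apply_of_forall_ne _ _ _ _ _ _ _ (by simp)
  refine ⟨ContinuousLinearEquiv.equivOfInverse (r₁.prod r₂) (i₁.coprod i₂) ?_ ?_⟩
  · intro f
    refine WeakLp.ext fun x => ?_
    change (i₁ (r₁ f)).toFun x + (i₂ (r₂ f)).toFun x = f.toFun x
    rcases x with a | b
    · rw [h11, h21, add_zero]; rfl
    · rw [h12, h22, zero_add]; rfl
  · rintro ⟨f, g⟩
    refine Prod.ext (WeakLp.ext fun x => ?_) (WeakLp.ext fun x => ?_)
    · change (i₁ f).toFun (Sum.inl x) + (i₂ g).toFun (Sum.inl x) = f.toFun x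
      rw [h11, h21, add_zero]
    · change (i₁ f).toFun (Sum.inr x) + (i₂ g).toFun (Sum.inr x) = g.toFun x
      rw [h12, h22, zero_add]

/-- Averaging is essentially a conditional expectation: test f on the union of the blocks over S and
use the triangle inequality. One factor C compares the integrals, the other the masses, where C^(1 -
1/p) ≤ C. -/
theorem sbound_average {T : Type v} {N : T → ℕ} (hN : ∀ t, 0 < N t) {w : (Σ t, Fin (N t)) → ℝ}
    {v : T → ℝ} (hp1 : 1 < p) (hw : ∀ x, 0 < w x) (hv : ∀ t, 0 < v t) {C : ℝ} (hC : 1 ≤ C)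
    (h₁ : ∀ x, v x.1 ≤ C * (w x * N x.1)) (h₂ : ∀ x, w x * N x.1 ≤ C * v x.1)
    {f : (Σ t, Fin (N t)) → ℝ} {K : ℝ} (hK : 0 ≤ K) (hf : SBound p w f K) :
    SBound p v (fun t => (N t : ℝ)⁻¹ * ∑ i, f ⟨t, i⟩) (C * C * K) := by
  classical
  intro S
  have hp0 : 0 < p := by linarith
  have hq : 0 ≤ 1 - 1 / p := by
    have : 1 / p < 1 := by rw [div_lt_one hp0]; exact hp1
    linarith
  have hq1 : 1 - 1 / p ≤ 1 := by
    have : 0 < 1 / p := by positivity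
    linarith
  have hN' : ∀ t, (0 : ℝ) < N t := fun t => by exact_mod_cast hN t
  have h1 := hf (S.sigma fun _ => Finset.univ)
  rw [Finset.sum_sigma, Finset.sum_sigma] at h1
  have h2 : ∑ t ∈ S, v t * |(N t : ℝ)⁻¹ * ∑ i, f ⟨t, i⟩| ≤
      C * ∑ t ∈ S, ∑ i, w ⟨t, i⟩ * |f ⟨t, i⟩| := by
    rw [Finset.mul_sum]
    refine Finset.sum_le_sum fun t _ => ?_
    rw [abs_mul, abs_of_pos (inv_pos.2 (hN' t))]
    calc v t * ((N t : ℝ)⁻¹ * |∑ i, f ⟨t, i⟩|)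
        ≤ v t * ((N t : ℝ)⁻¹ * ∑ i, |f ⟨t, i⟩|) := by
          have := hv t
          have := hN' t
          gcongr
          exact Finset.abs_sum_le_sum_abs _ _
      _ = ∑ i, v t * (N t : ℝ)⁻¹ * |f ⟨t, i⟩| := by rw [← mul_assoc, Finset.mul_sum]
      _ ≤ ∑ i, C * (w ⟨t, i⟩ * |f ⟨t, i⟩|) := by
          refine Finset.sum_le_sum fun i _ => ?_
          rw [← mul_assoc]
          refine mul_le_mul_of_nonneg_right ?_ (abs_nonneg _)
          rw [← div_eq_mul_inv, div_le_iff₀ (hN' t), mul_assoc]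
          exact h₁ ⟨t, i⟩
      _ = _ := by rw [Finset.mul_sum]
  have h3 : ∑ t ∈ S, ∑ i, w ⟨t, i⟩ ≤ C * ∑ t ∈ S, v t := by
    rw [Finset.mul_sum]
    refine Finset.sum_le_sum fun t _ => ?_
    calc ∑ i : Fin (N t), w ⟨t, i⟩ ≤ ∑ i : Fin (N t), C * v t / N t := by
          refine Finset.sum_le_sum fun i _ => ?_
          rw [le_div_iff₀ (hN' t)]
          exact h₂ ⟨t, i⟩
      _ = C * v t := by
          rw [Finset.sum_const, Finset.card_univ, Fintype.card_fin, nsmul_eq_mul]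
          have := (hN' t).ne'
          field_simp
  have hv0 : 0 ≤ ∑ t ∈ S, v t := Finset.sum_nonneg fun t _ => (hv t).le
  have hw0 : 0 ≤ ∑ t ∈ S, ∑ i, w ⟨t, i⟩ :=
    Finset.sum_nonneg fun t _ => Finset.sum_nonneg fun i _ => (hw _).le
  calc ∑ t ∈ S, v t * |(N t : ℝ)⁻¹ * ∑ i, f ⟨t, i⟩|
      ≤ C * (K * (∑ t ∈ S, ∑ i, w ⟨t, i⟩) ^ (1 - 1 / p)) := h2.trans (by gcongr)
    _ ≤ C * (K * (C * ∑ t ∈ S, v t) ^ (1 - 1 / p)) := by gcongr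
    _ = C * (K * (C ^ (1 - 1 / p) * (∑ t ∈ S, v t) ^ (1 - 1 / p))) := by
        rw [Real.mul_rpow (by linarith) hv0]
    _ ≤ C * (K * (C * (∑ t ∈ S, v t) ^ (1 - 1 / p))) := by
        gcongr
        exact Real.rpow_le_self_of_one_le hC hq1
    _ = _ := by ring

/-- The embedding spreads a value constantly over its block, and the projection averages over
blocks. The hypotheses say that a block has about the mass of the atom that it replaces. -/
theorem retract_of_blocks (p : ℝ) [hp : Fact (1 < p)] {T : Type v} {w : A → ℝ} {v : T → ℝ}
    (hw : ∀ a, 0 < w a) (hv : ∀ t, 0 < v t) {N : T → ℕ} (hN : ∀ t, 0 < N t)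
    {e : (Σ t, Fin (N t)) → A} (he : Function.Injective e) {C : ℝ} (hC : 1 ≤ C)
    (h₁ : ∀ x, v x.1 ≤ C * (w (e x) * N x.1)) (h₂ : ∀ x, w (e x) * N x.1 ≤ C * v x.1) :
    Retract (WeakLp p v) (WeakLp p w) := by
  have hp1 := hp.out
  have hN' : ∀ t, (0 : ℝ) < N t := fun t => by exact_mod_cast hN t
  have hs := one_le_sconst hp1
  refine Retract.trans (Y := WeakLp p (w ∘ e)) ?_
    (retract_of_injective p (fun x => hw _) hw he le_rfl (fun a => by simp) (fun a => by simp))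
  refine ⟨compCLM p (fun x => hw _) hv Sigma.fst hC ?_,
    clmOfBound (fun x => hw _) hv
      { toFun := fun f t => (N t : ℝ)⁻¹ * ∑ i, f.toFun ⟨t, i⟩
        map_add' := fun f g => funext fun t => ?_
        map_smul' := fun a f => funext fun t => ?_ } (C * C * sconst p) (by positivity) ?_, ?_⟩
  · rintro t S hS
    have : S ⊆ Finset.univ.map (Function.Embedding.sigmaMk (β := fun t => Fin (N t)) t) := by
      rintro ⟨s, i⟩ hx
      obtain rfl : s = t := hS _ hx
      simp
    refine (Finset.sum_le_sum_of_subset_of_nonneg this fun x _ _ => (hw _).le).trans ?_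
    rw [Finset.sum_map]
    calc ∑ i : Fin (N t), w (e ⟨t, i⟩) ≤ ∑ i : Fin (N t), C * v t / N t := by
          refine Finset.sum_le_sum fun i _ => ?_
          rw [le_div_iff₀ (hN' t)]
          exact h₂ ⟨t, i⟩
      _ = C * v t := by
          rw [Finset.sum_const, Finset.card_univ, Fintype.card_fin, nsmul_eq_mul]
          have := (hN' t).ne'
          field_simp
  · change (N t : ℝ)⁻¹ * ∑ i, (f.toFun ⟨t, i⟩ + g.toFun ⟨t, i⟩) = _
    rw [Finset.sum_add_distrib, mul_add]; rfl
  · change (N t : ℝ)⁻¹ * ∑ i, (a * f.toFun ⟨t, i⟩) = a * ((N t : ℝ)⁻¹ * ∑ i, f.toFun ⟨t, i⟩)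
    rw [← Finset.mul_sum]; ring
  · intro f K hK hf
    rw [mul_assoc]
    exact (sbound_average hN hp1 (fun x => hw _) hv hC h₁ h₂ (by positivity)
      (hf.sbound (fun x => hw _) hK hp1)).wbound hv (by positivity) hp1
  · intro f
    refine WeakLp.ext fun t => ?_
    change (N t : ℝ)⁻¹ * ∑ i : Fin (N t), f.toFun t = f.toFun t
    rw [Finset.sum_const, Finset.card_univ, Fintype.card_fin, nsmul_eq_mul]
    have := (hN' t).ne'
    field_simp

end

/-! ### Stacking dilated truncations of a countable weight -/

noncomputable section

open Filter Topology

section Stack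

variable {p : ℝ} (v : ℕ → ℝ)

/-- The total mass of the stacked truncations of `(ℕ, v)` below level `j`. -/
def stackSum : ℕ → ℝ
  | 0 => 0
  | j + 1 => stackSum j + ∑ k ∈ Finset.range j,
      ((∑ k ∈ Finset.range j, (v k)⁻¹) * (stackSum j + 1)) * v k

/-- The factor by which the truncation to `{k | k < j}` is dilated in the stack. -/
def stackMul (j : ℕ) : ℝ := (∑ k ∈ Finset.range j, (v k)⁻¹) * (stackSum v j + 1)

/-- The weight of the stack, with dummy atoms of mass one above the diagonal. -/
def stackWeight (x : ℕ × ℕ) : ℝ := if x.2 < x.1 then stackMul v x.1 * v x.2 else 1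

variable {v}

theorem stackSum_succ (j : ℕ) :
    stackSum v (j + 1) = stackSum v j + ∑ k ∈ Finset.range j, stackMul v j * v k := rfl

theorem stackSum_nonneg (hv : ∀ k, 0 < v k) (j : ℕ) : 0 ≤ stackSum v j := by
  induction j with
  | zero => exact le_rfl
  | succ j ih =>
    rw [stackSum]
    have h1 : 0 ≤ ∑ k ∈ Finset.range j, (v k)⁻¹ :=
      Finset.sum_nonneg fun k _ => (inv_pos.2 (hv k)).le
    have h2 : 0 ≤ ∑ k ∈ Finset.range j,
      ((∑ k ∈ Finset.range j, (v k)⁻¹) * (stackSum v j + 1)) * v k :=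
      Finset.sum_nonneg fun k _ => mul_nonneg (by positivity) (hv k).le
    linarith

theorem inv_le_sum_inv (hv : ∀ k, 0 < v k) {j k : ℕ} (h : k < j) :
    (v k)⁻¹ ≤ ∑ k ∈ Finset.range j, (v k)⁻¹ :=
  Finset.single_le_sum (f := fun k => (v k)⁻¹) (fun k _ => (inv_pos.2 (hv k)).le)
    (Finset.mem_range.2 h)

theorem stackMul_nonneg (hv : ∀ k, 0 < v k) (j : ℕ) : 0 ≤ stackMul v j := by
  have := stackSum_nonneg hv j
  have h1 : 0 ≤ ∑ k ∈ Finset.range j, (v k)⁻¹ :=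
    Finset.sum_nonneg fun k _ => (inv_pos.2 (hv k)).le
  rw [stackMul]
  positivity

theorem one_le_stackMul_mul (hv : ∀ k, 0 < v k) {j k : ℕ} (h : k < j) :
    1 ≤ stackMul v j * v k := by
  have h0 := stackSum_nonneg hv j
  have h1 := inv_le_sum_inv hv h
  have h2 := hv k
  calc (1 : ℝ) = (v k)⁻¹ * 1 * v k := by field_simp
    _ ≤ (∑ k ∈ Finset.range j, (v k)⁻¹) * (stackSum v j + 1) * v k := by
      gcongr
      · exact (inv_pos.2 h2).le.trans h1
      · linarith

theorem stackMul_pos (hv : ∀ k, 0 < v k) {j k : ℕ} (h : k < j) : 0 < stackMul v j := by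
  have := one_le_stackMul_mul hv h
  have h2 := hv k
  by_contra hn
  nlinarith [stackMul_nonneg hv j]

theorem one_le_stackWeight (hv : ∀ k, 0 < v k) (x : ℕ × ℕ) : 1 ≤ stackWeight v x := by
  rw [stackWeight]
  split_ifs with h
  exacts [one_le_stackMul_mul hv h, le_rfl]

theorem sum_stackWeight_lt (hv : ∀ k, 0 < v k) (A : Finset (ℕ × ℕ)) (hA : ∀ x ∈ A, x.2 < x.1)
    (J : ℕ) : ∑ x ∈ A with x.1 < J, stackWeight v x ≤ stackSum v J := by
  induction J with
  | zero => simp [stackSum]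
  | succ J ih =>
    have h1 : (A.filter fun x => x.1 < J + 1) =
        (A.filter fun x => x.1 < J) ∪ (A.filter fun x => x.1 = J) := by
      ext x
      simp only [Finset.mem_filter, Finset.mem_union]
      constructor
      · rintro ⟨h, h'⟩
        rcases Nat.lt_succ_iff_lt_or_eq.1 h' with h'' | h''
        exacts [Or.inl ⟨h, h''⟩, Or.inr ⟨h, h''⟩]
      · rintro (⟨h, h'⟩ | ⟨h, h'⟩)
        exacts [⟨h, by omega⟩, ⟨h, by omega⟩]
    have h2 : Disjoint (A.filter fun x => x.1 < J) (A.filter fun x => x.1 = J) := by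
      rw [Finset.disjoint_filter]
      intro x _ h h'
      omega
    rw [h1, Finset.sum_union h2, stackSum_succ]
    refine add_le_add ih ?_
    have h3 : ∑ x ∈ A with x.1 = J, stackWeight v x =
        ∑ k ∈ (A.filter fun x => x.1 = J).image Prod.snd, stackMul v J * v k := by
      rw [Finset.sum_image]
      · refine Finset.sum_congr rfl fun x hx => ?_
        obtain ⟨hxA, rfl⟩ := Finset.mem_filter.1 hx
        rw [stackWeight, if_pos (hA x hxA)]
      · intro x hx y hy hxy
        have hx' := (Finset.mem_filter.1 hx).2
        have hy' := (Finset.mem_filter.1 hy).2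
        exact Prod.ext (hx'.trans hy'.symm) hxy
    rw [h3]
    refine Finset.sum_le_sum_of_subset_of_nonneg ?_ fun k _ _ =>
      mul_nonneg (stackMul_nonneg hv J) (hv k).le
    intro k hk
    obtain ⟨x, hx, rfl⟩ := Finset.mem_image.1 hk
    obtain ⟨hxA, rfl⟩ := Finset.mem_filter.1 hx
    exact Finset.mem_range.2 (hA x hxA)

/-- In a finite part of a superlevel set only the highest slice J that it meets matters. That slice
is a dilated piece of a superlevel set of f. By the growth of `stackMul`, all lower slices together
weigh no more than any single atom of slice J. Each part costs K^p. -/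
theorem wbound_stack (hp1 : 1 < p) (hv : ∀ k, 0 < v k) {f : ℕ → ℝ} {K : ℝ} (hK : 0 < K)
    (hf : WBound p v f K) :
    WBound p (stackWeight v)
      (fun x => if x.2 < x.1 then stackMul v x.1 ^ (-(1 / p)) * f x.2 else 0) (2 * K) := by
  refine WBound.of_le hp1 one_le_two hK.le fun c hc A hA => ?_
  have hp0 : 0 < p := by linarith
  have hlt : ∀ x ∈ A, x.2 < x.1 := by
    intro x hx
    by_contra hn
    have := hA x hx
    rw [if_neg hn, abs_zero] at this
    exact lt_asymm hc this
  have hval : ∀ x ∈ A, c * stackMul v x.1 ^ (1 / p) < |f x.2| := by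
    intro x hx
    have h1 := hA x hx
    have h2 := stackMul_pos hv (hlt x hx)
    rw [if_pos (hlt x hx), abs_mul, abs_of_pos (by positivity), Real.rpow_neg h2.le,
      ← div_eq_inv_mul, lt_div_iff₀ (by positivity)] at h1
    exact h1
  have hpow : ∀ j, (c * stackMul v j ^ (1 / p)) ^ p = c ^ p * stackMul v j := by
    intro j
    have := stackMul_nonneg hv j
    rw [Real.mul_rpow hc.le (by positivity), ← Real.rpow_mul this]
    simp [hp0.ne']
  rcases A.eq_empty_or_nonempty with rfl | hne
  · simp; positivity
  obtain ⟨z, hz, hmax⟩ := A.exists_max_image Prod.fst hne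
  have hJ := stackMul_pos hv (hlt z hz)
  have hsplit : A = (A.filter fun x => x.1 < z.1) ∪ (A.filter fun x => x.1 = z.1) := by
    ext x
    simp only [Finset.mem_filter, Finset.mem_union]
    constructor
    · intro h
      rcases (hmax x h).lt_or_eq with h' | h'
      exacts [Or.inl ⟨h, h'⟩, Or.inr ⟨h, h'⟩]
    · rintro (h | h) <;> exact h.1
  have hdisj : Disjoint (A.filter fun x => x.1 < z.1) (A.filter fun x => x.1 = z.1) := by
    rw [Finset.disjoint_filter]
    intro x _ h h'
    omega
  have hlow : c ^ p * stackSum v z.1 ≤ K ^ p := by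
    have h1 := hf (c * stackMul v z.1 ^ (1 / p)) (by positivity) {z.2}
      (by simpa only [Finset.mem_singleton, forall_eq] using hval z hz)
    rw [hpow, Finset.sum_singleton] at h1
    refine le_trans ?_ h1
    rw [mul_assoc]
    gcongr
    have h0 := stackSum_nonneg hv z.1
    have h3 := inv_le_sum_inv hv (hlt z hz)
    have h4 := hv z.2
    calc stackSum v z.1 ≤ (v z.2)⁻¹ * (stackSum v z.1 + 1) * v z.2 := by
          field_simp
          linarith
      _ ≤ stackMul v z.1 * v z.2 := by
          rw [stackMul]
          gcongr
  have htop : c ^ p * ∑ x ∈ A with x.1 = z.1, stackWeight v x ≤ K ^ p := by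
    have h1 := hf (c * stackMul v z.1 ^ (1 / p)) (by positivity)
      ((A.filter fun x => x.1 = z.1).image Prod.snd) (by
        intro k hk
        obtain ⟨x, hx, rfl⟩ := Finset.mem_image.1 hk
        obtain ⟨hxA, hx1⟩ := Finset.mem_filter.1 hx
        rw [← hx1]
        exact hval x hxA)
    rw [hpow, mul_assoc, Finset.mul_sum, Finset.sum_image] at h1
    · refine le_of_eq_of_le ?_ h1
      congr 1
      refine Finset.sum_congr rfl fun x hx => ?_
      obtain ⟨hxA, hx1⟩ := Finset.mem_filter.1 hx
      rw [stackWeight, if_pos (hlt x hxA), hx1]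
    · intro x hx y hy hxy
      have hx' := (Finset.mem_filter.1 hx).2
      have hy' := (Finset.mem_filter.1 hy).2
      exact Prod.ext (hx'.trans hy'.symm) hxy
  rw [hsplit, Finset.sum_union hdisj, mul_add]
  have hlow' : c ^ p * ∑ x ∈ A with x.1 < z.1, stackWeight v x ≤ c ^ p * stackSum v z.1 := by
    gcongr
    exact sum_stackWeight_lt hv A hlt z.1
  linarith

/-- The value at `k` of the `j`-th slice of a function on the stack. -/
def slice (p : ℝ) (v : ℕ → ℝ) (g : ℕ × ℕ → ℝ) (k j : ℕ) : ℝ :=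
  if k < j then stackMul v j ^ (1 / p) * g (j, k) else 0

/-- Undoing the dilation by m = `stackMul v j` divides both sides of the bound by m^(1 - 1/p), so
the constant is uniform in j. -/
theorem sbound_slice (hp1 : 1 < p) (hv : ∀ k, 0 < v k) {g : ℕ × ℕ → ℝ} {K : ℝ} (hK : 0 ≤ K)
    (hg : SBound p (stackWeight v) g K) (j : ℕ) : SBound p v (fun k => slice p v g k j) K := by
  intro A
  have hp0 : 0 < p := by linarith
  have hq : 0 ≤ 1 - 1 / p := by
    have : 1 / p < 1 := by rw [div_lt_one hp0]; exact hp1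
    linarith
  have hsum : ∀ B : Finset ℕ, 0 ≤ ∑ k ∈ B, v k := fun B => Finset.sum_nonneg fun k _ => (hv k).le
  have h0 : ∑ k ∈ A, v k * |slice p v g k j| =
      ∑ k ∈ A with k < j, v k * (stackMul v j ^ (1 / p) * |g (j, k)|) := by
    rw [Finset.sum_filter]
    refine Finset.sum_congr rfl fun k _ => ?_
    have := stackMul_nonneg hv j
    simp only [slice]
    split_ifs
    · rw [abs_mul, abs_of_nonneg (by positivity)]
    · simp
  rw [h0]
  rcases (A.filter fun k => k < j).eq_empty_or_nonempty with he | ⟨k₀, hk₀⟩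
  · rw [he, Finset.sum_empty]
    have := hsum A
    positivity
  have hm : 0 < stackMul v j := stackMul_pos hv (Finset.mem_filter.1 hk₀).2
  have h1 := hg ((A.filter fun k => k < j).map (Function.Embedding.sectR j ℕ))
  rw [Finset.sum_map, Finset.sum_map] at h1
  have h2 : ∑ k ∈ A with k < j, stackWeight v (Function.Embedding.sectR j ℕ k) =
      stackMul v j * ∑ k ∈ A with k < j, v k := by
    rw [Finset.mul_sum]
    refine Finset.sum_congr rfl fun k hk => ?_
    simp [stackWeight, (Finset.mem_filter.1 hk).2]
  have h3 : ∑ k ∈ A with k < j, stackWeight v (Function.Embedding.sectR j ℕ k) *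
      |g (Function.Embedding.sectR j ℕ k)| = stackMul v j ^ (1 - 1 / p) *
        ∑ k ∈ A with k < j, v k * (stackMul v j ^ (1 / p) * |g (j, k)|) := by
    rw [Finset.mul_sum]
    refine Finset.sum_congr rfl fun k hk => ?_
    have h4 : stackMul v j = stackMul v j ^ (1 - 1 / p) * stackMul v j ^ (1 / p) := by
      rw [← Real.rpow_add hm]; simp
    simp only [stackWeight, Function.Embedding.sectR_apply, (Finset.mem_filter.1 hk).2, if_true]
    nth_rewrite 1 [h4]
    ring
  rw [h2, h3, Real.mul_rpow hm.le (hsum _)] at h1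
  have h5 : 0 < stackMul v j ^ (1 - 1 / p) := by positivity
  have h6 : ∑ k ∈ A with k < j, v k * (stackMul v j ^ (1 / p) * |g (j, k)|) ≤
      K * (∑ k ∈ A with k < j, v k) ^ (1 - 1 / p) := by
    refine le_of_mul_le_mul_left ?_ h5
    linarith
  refine h6.trans ?_
  gcongr
  · exact hsum _
  · exact fun i _ _ => (hv i).le
  · exact Finset.filter_subset _ _

/-- The limit of the slices along a nonprincipal ultrafilter. -/
def sliceLim (p : ℝ) (v : ℕ → ℝ) (g : ℕ × ℕ → ℝ) (k : ℕ) : ℝ :=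
  limUnder (hyperfilter ℕ : Filter ℕ) (slice p v g k)

theorem tendsto_slice (hp1 : 1 < p) (hv : ∀ k, 0 < v k) {g : ℕ × ℕ → ℝ} {K : ℝ} (hK : 0 ≤ K)
    (hg : SBound p (stackWeight v) g K) (k : ℕ) :
    Tendsto (slice p v g k) (hyperfilter ℕ) (𝓝 (sliceLim p v g k)) := by
  set R := K * v k ^ (1 - 1 / p) / v k
  have hb : ∀ j, slice p v g k j ∈ Set.Icc (-R) R := by
    intro j
    have h := sbound_slice hp1 hv hK hg j {k}
    rw [Finset.sum_singleton, Finset.sum_singleton] at h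
    rw [Set.mem_Icc, ← abs_le, le_div_iff₀ (hv k), mul_comm]
    exact h
  obtain ⟨L, _, hL⟩ := (isCompact_Icc (a := -R) (b := R)).ultrafilter_le_nhds
    ((hyperfilter ℕ).map (slice p v g k)) (by
      rw [Filter.le_principal_iff]
      exact Filter.mem_map.2 (Filter.univ_mem' hb))
  exact tendsto_nhds_limUnder ⟨L, hL⟩

/-- The bound involves finitely many coordinates at a time, so it survives pointwise limits. -/
theorem sbound_sliceLim (hp1 : 1 < p) (hv : ∀ k, 0 < v k) {g : ℕ × ℕ → ℝ} {K : ℝ} (hK : 0 ≤ K)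
    (hg : SBound p (stackWeight v) g K) : SBound p v (sliceLim p v g) K := by
  intro A
  refine le_of_tendsto (f := fun j => ∑ k ∈ A, v k * |slice p v g k j|)
    (x := (hyperfilter ℕ : Filter ℕ)) ?_
    (Filter.Eventually.of_forall fun j => sbound_slice hp1 hv hK hg j A)
  exact tendsto_finsetSum _ fun k _ => ((tendsto_slice hp1 hv hK hg k).abs).const_mul _

/-- This trades arbitrarily small atoms for atoms of mass at least 1. The k-th coordinate of the
j-th slice of an embedded f is f k once j > k, and a nonprincipal ultrafilter ignores the remaining
j. -/
theorem retract_stack (p : ℝ) [hp : Fact (1 < p)] (hv : ∀ k, 0 < v k) :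
    Retract (WeakLp p v) (WeakLp p (stackWeight v)) := by
  have hp1 := hp.out
  have hs := one_le_sconst hp1
  have hu : ∀ x, 0 < stackWeight v x := fun x => one_pos.trans_le (one_le_stackWeight hv x)
  have hlim : ∀ (g : WeakLp p (stackWeight v)) (k : ℕ),
      Tendsto (slice p v g.toFun k) (hyperfilter ℕ) (𝓝 (sliceLim p v g.toFun k)) := by
    intro g k
    obtain ⟨K, hK, hg⟩ := exists_wbound hu g
    exact tendsto_slice hp1 hv (by positivity) (hg.sbound hu hK hp1) k
  refine ⟨clmOfBound hv hu
      { toFun := fun f x => if x.2 < x.1 then stackMul v x.1 ^ (-(1 / p)) * f.toFun x.2 else 0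
        map_add' := fun f g => funext fun x => ?_
        map_smul' := fun a f => funext fun x => ?_ } 2 (by norm_num)
      fun f K hK hf => wbound_stack hp1 hv hK hf,
    clmOfBound hu hv
      { toFun := fun g => sliceLim p v g.toFun
        map_add' := fun f g => funext fun k => ?_
        map_smul' := fun a f => funext fun k => ?_ } (sconst p) (by linarith)
      fun g K hK hg => (sbound_sliceLim hp1 hv (by positivity) (hg.sbound hu hK hp1)).wbound hv
        (by positivity) hp1, ?_⟩
  · change (if x.2 < x.1 then stackMul v x.1 ^ (-(1 / p)) * (f.toFun x.2 + g.toFun x.2) else 0) =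
      (if x.2 < x.1 then stackMul v x.1 ^ (-(1 / p)) * f.toFun x.2 else 0) +
      (if x.2 < x.1 then stackMul v x.1 ^ (-(1 / p)) * g.toFun x.2 else 0)
    split_ifs <;> ring
  · change (if x.2 < x.1 then stackMul v x.1 ^ (-(1 / p)) * (a * f.toFun x.2) else 0) =
      a * (if x.2 < x.1 then stackMul v x.1 ^ (-(1 / p)) * f.toFun x.2 else 0)
    split_ifs <;> ring
  · refine tendsto_nhds_unique (hlim (f + g) k) (((hlim f k).add (hlim g k)).congr fun j => ?_)
    change slice p v f.toFun k j + slice p v g.toFun k j = slice p v (f.toFun + g.toFun) k j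
    simp only [slice, Pi.add_apply]
    split_ifs <;> ring
  · refine tendsto_nhds_unique (hlim (a • f) k) (((hlim f k).const_mul a).congr fun j => ?_)
    change a * slice p v f.toFun k j = slice p v (a • f.toFun) k j
    simp only [slice, Pi.smul_apply, smul_eq_mul]
    split_ifs <;> ring
  · intro f
    refine WeakLp.ext fun k => ?_
    refine tendsto_nhds_unique (hlim _ k) ?_
    refine tendsto_const_nhds.congr' ?_
    have h1 : ∀ᶠ j in (hyperfilter ℕ : Filter ℕ), k < j :=
      Nat.hyperfilter_le_atTop (eventually_gt_atTop k)
    filter_upwards [h1] with j hj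
    have hm := stackMul_pos hv hj
    rw [slice, if_pos hj, clmOfBound_toFun]
    change f.toFun k = stackMul v j ^ (1 / p) *
      (if k < j then stackMul v j ^ (-(1 / p)) * f.toFun k else 0)
    rw [if_pos hj, ← mul_assoc, ← Real.rpow_add hm]
    simp

end Stack

end

/-! ### Ample weights and what they contain -/

noncomputable section

/-- Up to a factor of two, every atom occurs with infinite multiplicity. -/
def Ample {Δ : Type*} (w : Δ → ℝ) : Prop :=
  ∃ φ : Δ × ℕ ≃ Δ, ∀ x, w (φ x) ≤ 2 * w x.1 ∧ w x.1 ≤ 2 * w (φ x)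

theorem nonempty_prod_nat_equiv (α : Type u) (h : Nonempty α → Infinite α) :
    Nonempty (α × ℕ ≃ α) := by
  rcases isEmpty_or_nonempty α with he | hne
  · exact ⟨Equiv.equivOfIsEmpty _ _⟩
  · have := h hne
    rw [← Cardinal.lift_mk_eq'.{u, u}]
    simp [Cardinal.mul_aleph0_eq]

/-- An infinite fibre is equipotent with its product with ℕ; the bijections are glued over the
fibres. -/
theorem ample_of_infinite_fibers {Δ : Type u} {β : Type*} {w : Δ → ℝ} (κ : Δ → β)
    (h : ∀ δ, Infinite {δ' // κ δ' = κ δ}) (hκ : ∀ δ δ', κ δ = κ δ' → w δ ≤ 2 * w δ') :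
    Ample w := by
  have g : ∀ y : β, Nonempty ({δ // κ δ = y} × ℕ ≃ {δ // κ δ = y}) := fun y =>
    nonempty_prod_nat_equiv {δ // κ δ = y} (by
      rintro ⟨δ, rfl⟩
      exact h δ)
  let φ : Δ × ℕ ≃ Δ := ((Equiv.prodCongr (Equiv.sigmaFiberEquiv κ).symm (Equiv.refl ℕ)).trans
    (Equiv.sigmaProdDistrib _ ℕ)).trans ((Equiv.sigmaCongrRight fun y => (g y).some).trans
      (Equiv.sigmaFiberEquiv κ))
  have hφ : ∀ x, κ (φ x) = κ x.1 := fun x => ((g (κ x.1)).some (⟨x.1, rfl⟩, x.2)).2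
  exact ⟨φ, fun x => ⟨hκ _ _ (hφ x), hκ _ _ (hφ x).symm⟩⟩

theorem Ample.isomorphic_prod_self {Δ : Type u} {w : Δ → ℝ} (p : ℝ) [hp : Fact (1 < p)]
    (hw : ∀ δ, 0 < w δ) (h : Ample w) : Isomorphic (WeakLp p w × WeakLp p w) (WeakLp p w) := by
  obtain ⟨φ, hφ⟩ := h
  let e : Δ ⊕ Δ ≃ Δ := (Equiv.sumCongr φ.symm φ.symm).trans
    ((Equiv.prodSumDistrib Δ ℕ ℕ).symm.trans
      ((Equiv.prodCongr (Equiv.refl Δ) Equiv.natSumNatEquivNat).trans φ))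
  have he : ∀ x, ∃ y n, φ y = Sum.elim id id x ∧ e x = φ (y.1, n) := by
    rintro (x | x)
    · exact ⟨φ.symm x, _, φ.apply_symm_apply x, rfl⟩
    · exact ⟨φ.symm x, _, φ.apply_symm_apply x, rfl⟩
  have hx : ∀ x, Sum.elim w w x = w (Sum.elim id id x) := by rintro (x | x) <;> rfl
  refine (isomorphic_sum p hw hw).symm.trans
    -- Both x and its image are copies of one atom, each within a factor 2 of it.
    (isomorphic_of_equiv p (sum_elim_pos hw hw) hw e (C := 4) (by norm_num) ?_ ?_)
  · intro x
    obtain ⟨y, n, h1, h2⟩ := he x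
    rw [hx, ← h1, h2]
    linarith [(hφ y).2, (hφ (y.1, n)).1]
  · intro x
    obtain ⟨y, n, h1, h2⟩ := he x
    rw [hx, ← h1, h2]
    linarith [(hφ y).1, (hφ (y.1, n)).2]

theorem isomorphic_prod_multiples {Γ : Type u} {w : Γ → ℝ} (p : ℝ) [hp : Fact (1 < p)]
    (hw : ∀ γ, 0 < w γ) :
    Isomorphic (WeakLp p w × WeakLp p fun x : Γ × ℕ => w x.1) (WeakLp p fun x : Γ × ℕ => w x.1) := by
  let e : Γ ⊕ Γ × ℕ ≃ Γ × ℕ := (Equiv.sumComm _ _).trans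
    ((Equiv.sumCongr (Equiv.refl _) (Equiv.prodPUnit.{0} Γ).symm).trans
      ((Equiv.prodSumDistrib Γ ℕ PUnit.{1}).symm.trans
        (Equiv.prodCongr (Equiv.refl Γ) Equiv.natEquivNatSumPUnit.{0}.symm)))
  have he : ∀ x, w (e x).1 = Sum.elim w (fun x : Γ × ℕ => w x.1) x := by
    rintro (x | x) <;> rfl
  have hv : ∀ x : Γ × ℕ, 0 < (fun x : Γ × ℕ => w x.1) x := fun x => hw x.1
  refine (isomorphic_sum p hw hv).symm.trans
    (isomorphic_of_equiv p (sum_elim_pos hw hv) hv e le_rfl (fun x => ?_) (fun x => ?_))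
  · rw [one_mul]; exact (he x).le
  · rw [one_mul]; exact (he x).ge

/-- The atom t is built from ⌈v t / w⌉ copies of a not much larger atom of Δ. The ℕ-coordinate of ψ
lets many t use the same atom. -/
theorem retract_of_ample {Δ : Type u} {T : Type v} {w : Δ → ℝ} {v : T → ℝ} (p : ℝ)
    [hp : Fact (1 < p)] (hw : ∀ δ, 0 < w δ) (hv : ∀ t, 0 < v t) (h : Ample w) (ψ : T → Δ × ℕ)
    (hψ : Function.Injective ψ) {C : ℝ} (hC : 1 ≤ C) (hle : ∀ t, w (ψ t).1 ≤ C * v t) :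
    Retract (WeakLp p v) (WeakLp p w) := by
  obtain ⟨φ, hφ⟩ := h
  have h1 : ∀ t, v t ≤ w (ψ t).1 * ⌈v t / w (ψ t).1⌉₊ := by
    intro t
    have h1 := Nat.le_ceil (v t / w (ψ t).1)
    rw [div_le_iff₀ (hw _)] at h1
    linarith
  have h2 : ∀ t, w (ψ t).1 * ⌈v t / w (ψ t).1⌉₊ ≤ 2 * C * v t := by
    intro t
    have h2 := (Nat.ceil_lt_add_one (a := v t / w (ψ t).1) (div_pos (hv t) (hw _)).le).le
    calc w (ψ t).1 * ⌈v t / w (ψ t).1⌉₊ ≤ w (ψ t).1 * (v t / w (ψ t).1 + 1) :=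
          mul_le_mul_of_nonneg_left h2 (hw _).le
      _ = v t + w (ψ t).1 := by
          have := (hw (ψ t).1).ne'
          field_simp
      _ ≤ 2 * C * v t := by nlinarith [hle t, hv t]
  refine retract_of_blocks p hw hv (N := fun t => ⌈v t / w (ψ t).1⌉₊)
    (fun t => Nat.ceil_pos.2 (div_pos (hv t) (hw _)))
    -- Pairing keeps the blocks of different t disjoint. Rounding up costs 2C, and the multiplicity
    -- in `Ample` a further 2.
    (e := fun x => φ ((ψ x.1).1, Nat.pair (ψ x.1).2 x.2)) ?_ (C := 4 * C) (by linarith) ?_ ?_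
  · rintro ⟨t, i⟩ ⟨t', i'⟩ hx
    have h3 := φ.injective hx
    simp only [Prod.mk.injEq, Nat.pair_eq_pair] at h3
    obtain rfl : t = t' := hψ (Prod.ext h3.1 h3.2.1)
    obtain rfl : i = i' := Fin.ext h3.2.2
    rfl
  · rintro ⟨t, i⟩
    have h3 := (hφ ((ψ t).1, Nat.pair (ψ t).2 i)).2
    have h4 := hw (φ ((ψ t).1, Nat.pair (ψ t).2 i))
    have h5 : (0 : ℝ) ≤ ⌈v t / w (ψ t).1⌉₊ := Nat.cast_nonneg _
    have h6 := mul_le_mul_of_nonneg_right h3 h5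
    have h7 := h1 t
    have h8 := mul_nonneg h4.le h5
    dsimp only at h6 ⊢
    nlinarith
  · rintro ⟨t, i⟩
    have h3 := (hφ ((ψ t).1, Nat.pair (ψ t).2 i)).1
    have h6 := mul_le_mul_of_nonneg_right h3 (Nat.cast_nonneg (α := ℝ) ⌈v t / w (ψ t).1⌉₊)
    have h7 := h2 t
    dsimp only at h6 ⊢
    linarith

/-- After stacking, all masses are at least 1, so the copies of one single atom of Δ suffice. -/
theorem retract_of_countable {Δ : Type u} {T : Type v} [Countable T] [Nonempty Δ] {w : Δ → ℝ}
    {v : T → ℝ} (p : ℝ) [hp : Fact (1 < p)] (hw : ∀ δ, 0 < w δ) (hv : ∀ t, 0 < v t)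
    (h : Ample w) : Retract (WeakLp p v) (WeakLp p w) := by
  obtain ⟨f, hf⟩ := exists_injective_nat T
  have hv' : ∀ k, 0 < Function.extend f v 1 k := by
    intro k
    by_cases hk : ∃ t, f t = k
    · obtain ⟨t, rfl⟩ := hk
      rw [hf.extend_apply]
      exact hv t
    · rw [Function.extend_apply' _ _ _ hk]
      exact one_pos
  have h1 : Retract (WeakLp p v) (WeakLp p (Function.extend f v 1)) :=
    retract_of_injective p hv hv' hf le_rfl (fun t => by rw [hf.extend_apply, one_mul])
      (fun t => by rw [hf.extend_apply, one_mul])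
  refine h1.trans ((retract_stack p hv').trans ?_)
  obtain ⟨δ⟩ := ‹Nonempty Δ›
  have hu := one_le_stackWeight hv'
  refine retract_of_ample p hw (fun x => one_pos.trans_le (hu x)) h
    (fun x => (δ, Nat.pair x.1 x.2)) ?_ (C := 1 + w δ) (by linarith [hw δ]) ?_
  · intro x y hxy
    simp only [Prod.mk.injEq, Nat.pair_eq_pair, true_and] at hxy
    exact Prod.ext hxy.1 hxy.2
  · intro x
    nlinarith [hu x, hw δ]

/-- The atoms whose dyadic scale contains infinitely many atoms. -/
def ampleSet {Δ : Type*} (w : Δ → ℝ) : Set Δ :=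
  {δ | Infinite {δ' // Int.log 2 (w δ') = Int.log 2 (w δ)}}

/-- There are countably many dyadic scales, and each discarded one is finite. -/
theorem countable_compl_ampleSet {Δ : Type*} (w : Δ → ℝ) : (ampleSet w)ᶜ.Countable := by
  refine Set.Countable.mono (s₂ := ⋃ k : {k : ℤ // Finite {δ' // Int.log 2 (w δ') = k}},
    {δ | Int.log 2 (w δ) = k.1}) ?_ (Set.countable_iUnion fun k => ?_)
  · intro δ hδ
    have : Finite {δ' // Int.log 2 (w δ') = Int.log 2 (w δ)} := not_infinite_iff_finite.1 hδ
    exact Set.mem_iUnion.2 ⟨⟨_, this⟩, rfl⟩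
  · have : Finite {δ | Int.log 2 (w δ) = k.1} := k.2
    exact (Set.finite_coe_iff.1 this).countable

theorem le_two_mul_of_log_eq {x y : ℝ} (hy : 0 < y) (h : Int.log 2 x = Int.log 2 y) :
    x ≤ 2 * y := by
  have h1 := Int.lt_zpow_succ_log_self (b := 2) one_lt_two x
  have h2 := Int.zpow_log_le_self (b := 2) one_lt_two hy
  rw [h, zpow_add_one₀ (by norm_num)] at h1
  push_cast at h1 h2
  linarith

theorem ample_ampleSet {Δ : Type u} {w : Δ → ℝ} (hw : ∀ δ, 0 < w δ) :
    Ample fun δ : ampleSet w => w δ := by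
  refine ample_of_infinite_fibers (fun δ : ampleSet w => Int.log 2 (w δ)) ?_
    fun δ δ' h => le_two_mul_of_log_eq (hw δ') h
  rintro ⟨δ, hδ⟩
  have h : Infinite {δ' // Int.log 2 (w δ') = Int.log 2 (w δ)} := hδ
  refine Infinite.of_injective (β := {δ' // Int.log 2 (w δ') = Int.log 2 (w δ)})
    (fun x => ⟨⟨x.1, ?_⟩, x.2⟩) ?_
  · rw [ampleSet, Set.mem_ofPred_eq, x.2]
    exact h
  · intro x y hxy
    simp only [Subtype.mk.injEq] at hxy
    exact Subtype.ext hxy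

theorem mk_le_mk_ampleSet {Δ : Type u} (w : Δ → ℝ) (A : Set Δ) (hA : ℵ₀ < #A) :
    #A ≤ #{δ : ampleSet w // δ.1 ∈ A} := by
  have h1 : #A ≤ #(A ∩ ampleSet w : Set Δ) + #(A \ ampleSet w : Set Δ) := by
    refine le_trans (Cardinal.mk_le_mk_of_subset ?_) (Cardinal.mk_union_le _ _)
    rw [Set.inter_union_sdiff]
  have h2 : #(A \ ampleSet w : Set Δ) ≤ ℵ₀ :=
    Cardinal.le_aleph0_iff_set_countable.2
      ((countable_compl_ampleSet w).mono fun x hx => hx.2)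
  have h3 : #(A ∩ ampleSet w : Set Δ) ≤ #{δ : ampleSet w // δ.1 ∈ A} :=
    Cardinal.mk_le_of_injective (f := fun x => ⟨⟨x.1, x.2.2⟩, x.2.1⟩) fun x y hxy => by
      simp only [Subtype.mk.injEq] at hxy
      exact Subtype.ext hxy
  have h4 := h1.trans (add_le_add h3 h2)
  by_contra hlt
  rw [not_le] at hlt
  exact absurd h4 (not_le.2 (Cardinal.add_lt_of_lt hA.le hlt hA))

/-- Each level of T injects into the ample atoms of mass at most b n, since dropping countably many
atoms does not hurt. Images of different levels may overlap; the level itself, used as multiplicity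
index, separates them. -/
theorem retract_of_levels {Δ T : Type u} {w : Δ → ℝ} {v : T → ℝ} (p : ℝ)
    [hp : Fact (1 < p)] (hw : ∀ δ, 0 < w δ) (hv : ∀ t, 0 < v t) (τ : T → ℕ) (b : ℕ → ℝ)
    (hb : ∀ n, ℵ₀ < #{δ // w δ ≤ b n}) (hτ : ∀ n, #{t // τ t = n} ≤ #{δ // w δ ≤ b n})
    {C : ℝ} (hC : 1 ≤ C) (hle : ∀ t, b (τ t) ≤ C * v t) :
    Retract (WeakLp p v) (WeakLp p w) := by
  have g : ∀ n, Nonempty ({t // τ t = n} ↪ {δ : ampleSet w // w δ.1 ≤ b n}) := fun n =>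
    (Cardinal.le_def _ _).1 ((hτ n).trans (mk_le_mk_ampleSet w {δ | w δ ≤ b n} (hb n)))
  refine Retract.trans (Y := WeakLp p fun δ : ampleSet w => w δ)
    (retract_of_ample p (fun δ => hw _) hv (ample_ampleSet hw)
      (fun t => (((g (τ t)).some ⟨t, rfl⟩).1, τ t)) ?_ hC
      fun t => ((g (τ t)).some ⟨t, rfl⟩).2.trans (hle t))
    (retract_of_injective p (fun δ => hw _) hw Subtype.val_injective le_rfl
      (fun δ => by rw [one_mul]) (fun δ => by rw [one_mul]))
  have key : ∀ m n t (ht : τ t = m) s (hs : τ s = n), m = n →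
      ((g m).some ⟨t, ht⟩).1 = ((g n).some ⟨s, hs⟩).1 → t = s := by
    rintro m n t ht s hs rfl hst
    have := (g m).some.injective (Subtype.ext hst)
    exact congrArg Subtype.val this
  intro t s hts
  simp only [Prod.mk.injEq] at hts
  exact key _ _ t rfl s rfl hts.2 hts.1

end

/-! ### The model spaces as complemented subspaces and superspaces -/

noncomputable section

variable (p : ℝ) [hp : Fact (1 < p)]

theorem ample_const (Γ : Type u) [Infinite Γ] : Ample fun _ : Γ => (1 : ℝ) :=
  ample_of_infinite_fibers (fun _ => ()) (fun _ => Infinite.of_injective (fun γ : Γ => ⟨γ, rfl⟩)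
    fun _ _ h => congrArg Subtype.val h) fun _ _ _ => by norm_num

theorem ample_E (P : ℕ → Type u) [∀ n, Infinite (P n)] :
    Ample fun x : (Σ n : ℕ, P n) => (2 : ℝ) ^ x.1 := by
  refine ample_of_infinite_fibers Sigma.fst (fun x => Infinite.of_injective
    (fun y : P x.1 => ⟨⟨x.1, y⟩, rfl⟩) fun y z h => ?_) fun x y h => ?_
  · simpa using h
  · rw [h]
    have : (0 : ℝ) < 2 ^ y.1 := by positivity
    linarith

theorem ample_F (Q : Type u) [Infinite Q] :
    Ample fun x : Q × ℕ+ => ((2 : ℝ) ^ (x.2 : ℕ))⁻¹ := by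
  refine ample_of_infinite_fibers Prod.snd (fun x => Infinite.of_injective
    (fun y : Q => ⟨(y, x.2), rfl⟩) fun y z h => ?_) fun x y h => ?_
  · simpa using h
  · rw [h]
    have : (0 : ℝ) < (2 ^ (y.2 : ℕ))⁻¹ := by positivity
    linarith

theorem F_retract {Q Δ : Type u} {w : Δ → ℝ} (hw : ∀ δ, 0 < w δ) (hQ : ℵ₀ < #Q)
    (h : ∀ n : ℕ, #Q ≤ #{δ // w δ ≤ (2 ^ n)⁻¹}) : Retract (F p Q) (WeakLp p w) := by
  refine retract_of_levels p hw (fun x => by positivity) (fun x => x.2) (fun n => (2 ^ n)⁻¹)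
    (fun n => hQ.trans_le (h n)) (fun n => le_trans ?_ (h n)) le_rfl (fun t => by rw [one_mul])
  refine Cardinal.mk_le_of_injective (f := fun t => t.1.1) ?_
  rintro ⟨⟨q, m⟩, h⟩ ⟨⟨q', m'⟩, h'⟩ hq
  exact Subtype.ext (Prod.ext hq (PNat.coe_injective (h.trans h'.symm)))

/-- F has atoms below every positive mass, so no lower bound on w is needed. -/
theorem retract_F {Q Δ : Type u} {w : Δ → ℝ} (hw : ∀ δ, 0 < w δ) [Infinite Q] (h : #Δ ≤ #Q) :
    Retract (WeakLp p fun x : Δ × ℕ => w x.1) (F p Q) := by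
  obtain ⟨g⟩ := h
  have hn : ∀ δ, ∃ n : ℕ+, ((2 : ℝ) ^ (n : ℕ))⁻¹ ≤ w δ := by
    intro δ
    obtain ⟨n, hn⟩ := pow_unbounded_of_one_lt (w δ)⁻¹ (one_lt_two (α := ℝ))
    refine ⟨n.succPNat, inv_le_of_inv_le₀ (hw δ) (hn.le.trans ?_)⟩
    exact pow_le_pow_right₀ one_le_two (Nat.le_succ n)
  choose n hn using hn
  refine retract_of_ample p (fun x => by positivity) (fun x => hw x.1) (ample_F Q)
    (fun x => ((g x.1, n x.1), x.2)) ?_ le_rfl (fun x => by rw [one_mul]; exact hn x.1)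
  intro x y hxy
  simp only [Prod.mk.injEq] at hxy
  exact Prod.ext (g.injective hxy.1.1) hxy.2

theorem L_retract {Γ Δ : Type u} {w : Δ → ℝ} (hw : ∀ δ, 0 < w δ) (hΓ : ℵ₀ < #Γ) {b : ℝ}
    (h : #Γ ≤ #{δ // w δ ≤ b}) : Retract (L p Γ) (WeakLp p w) :=
  retract_of_levels p hw (fun _ => one_pos) (fun _ => 0) (fun _ => b)
    -- The sign of b is not assumed.
    (fun _ => hΓ.trans_le h) (fun _ => le_trans (Cardinal.mk_subtype_le _) h) (C := 1 + |b|)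
    (by linarith [abs_nonneg b]) fun _ => by linarith [le_abs_self b]

theorem retract_L {Γ Δ : Type u} {w : Δ → ℝ} (hw : ∀ δ, 0 < w δ) [Infinite Γ] (h : #Δ ≤ #Γ)
    {a : ℝ} (ha : 0 < a) (hwa : ∀ δ, a < w δ) :
    Retract (WeakLp p fun x : Δ × ℕ => w x.1) (L p Γ) := by
  obtain ⟨g⟩ := h
  refine retract_of_ample p (fun _ => one_pos) (fun x => hw x.1) (ample_const Γ)
    (fun x => (g x.1, x.2)) ?_ (C := 1 + a⁻¹) (by linarith [inv_pos.2 ha]) fun x => ?_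
  · intro x y hxy
    simp only [Prod.mk.injEq] at hxy
    exact Prod.ext (g.injective hxy.1) hxy.2
  · have h1 : 1 ≤ a⁻¹ * w x.1 := by
      rw [← div_eq_inv_mul, one_le_div ha]
      exact (hwa x.1).le
    nlinarith [hw x.1]

/-- The atoms of mass at most `2^n b`. -/
abbrev Below {Δ : Type u} (w : Δ → ℝ) (b : ℝ) (n : ℕ) : Type u := {δ // w δ ≤ 2 ^ n * b}

theorem E_retract {Δ : Type u} {w : Δ → ℝ} (hw : ∀ δ, 0 < w δ) {b : ℝ} (hb : 0 < b)
    (h : ∀ n, ℵ₀ < #(Below w b n)) : Retract (E p (Below w b)) (WeakLp p w) := by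
  refine retract_of_levels p hw (fun x => by positivity) Sigma.fst (fun n => 2 ^ n * b) h
    (fun n => ?_) (C := 1 + b) (by linarith) (fun x => ?_)
  · refine Cardinal.mk_le_of_injective
      (f := fun t => ⟨t.1.2.1, t.1.2.2.trans (by rw [t.2])⟩) ?_
    rintro ⟨⟨m, x⟩, rfl⟩ ⟨⟨m', x'⟩, h'⟩ hx
    obtain rfl : m' = m := h'
    simp only [Subtype.mk.injEq] at hx
    obtain rfl : x = x' := Subtype.ext hx
    rfl
  · have : (0 : ℝ) < 2 ^ x.1 := by positivity
    linarith

/-- Send δ to the least level n that contains it. If n > 0, minimality gives 2^n < 2 w δ / b; if n =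
0, the lower bound a gives 1 ≤ w δ / a. -/
theorem retract_E {Δ : Type u} {w : Δ → ℝ} (hw : ∀ δ, 0 < w δ) {b : ℝ} (hb : 0 < b)
    (h : ∀ n, ℵ₀ < #(Below w b n)) {a : ℝ} (ha : 0 < a) (hwa : ∀ δ, a < w δ) :
    Retract (WeakLp p fun x : Δ × ℕ => w x.1) (E p (Below w b)) := by
  have : ∀ n, Infinite (Below w b n) := fun n => Cardinal.infinite_iff.2 (h n).le
  have hn : ∀ δ, ∃ n : ℕ, w δ ≤ 2 ^ n * b ∧ 2 ^ n ≤ (1 + a⁻¹ + 2 * b⁻¹) * w δ := by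
    intro δ
    have h0 : ∃ n : ℕ, w δ ≤ 2 ^ n * b := by
      obtain ⟨n, hn⟩ := pow_unbounded_of_one_lt (w δ / b) (one_lt_two (α := ℝ))
      exact ⟨n, (div_le_iff₀ hb).1 hn.le⟩
    classical
    refine ⟨Nat.find h0, Nat.find_spec h0, ?_⟩
    have hwδ := hw δ
    have h1 : 1 ≤ a⁻¹ * w δ := by
      rw [← div_eq_inv_mul, one_le_div ha]
      exact (hwa δ).le
    have h2 : 0 < b⁻¹ * w δ := by positivity
    rcases hm : Nat.find h0 with _ | m
    · rw [pow_zero]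
      linarith
    · have h3 := Nat.find_min h0 (m := m) (by omega)
      rw [not_le] at h3
      have h4 : 2 ^ m ≤ b⁻¹ * w δ := by
        rw [← div_eq_inv_mul, le_div_iff₀ hb]
        exact h3.le
      rw [pow_succ]
      linarith
  choose n hn hn' using hn
  refine retract_of_ample p (fun x => by positivity) (fun x => hw x.1) (ample_E _)
    (fun x => (⟨n x.1, ⟨x.1, hn x.1⟩⟩, x.2)) ?_ (C := 1 + a⁻¹ + 2 * b⁻¹)
    (by linarith [inv_pos.2 ha, inv_pos.2 hb]) (fun x => hn' x.1)
  intro x y hxy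
  exact Prod.ext (congrArg (fun z : (Σ n, Below w b n) × ℕ => z.1.2.1) hxy)
    (congrArg (fun z : (Σ n, Below w b n) × ℕ => z.2) hxy)

theorem exists_aleph0_lt_mk_le {Δ : Type u} (w : Δ → ℝ) (hΔ : ℵ₀ < #Δ) :
    ∃ n : ℕ, ℵ₀ < #{δ // w δ ≤ n} := by
  by_contra! h
  refine absurd hΔ (not_lt.2 (Cardinal.mk_le_aleph0_iff.2 ?_))
  rw [← Set.countable_univ_iff]
  refine Set.Countable.mono (s₂ := ⋃ n : ℕ, {δ | w δ ≤ n}) ?_ (Set.countable_iUnion fun n => ?_)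
  · intro δ _
    obtain ⟨n, hn⟩ := exists_nat_ge (w δ)
    exact Set.mem_iUnion.2 ⟨n, hn⟩
  · exact Cardinal.le_aleph0_iff_set_countable.1 (h n)

/-- Countably many levels exhaust Δ, so |Γ| ≤ ℵ₀ · sup, and the factor ℵ₀ is absorbed because the
supremum is infinite. -/
theorem admissible_below {Γ Δ : Type u} (hΔ : #Δ = #Γ) {w : Δ → ℝ} {b : ℝ} (hb : 0 < b)
    (h : ∀ n, ℵ₀ < #(Below w b n)) (hlt : ∀ c, #{δ // w δ ≤ c} < #Γ) :
    Admissible Γ (Below w b) := by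
  have hbdd : BddAbove (Set.range fun n => #(Below w b n)) := Cardinal.bddAbove_of_small
  have hsup : ⨆ n, #(Below w b n) = #Γ := by
    refine le_antisymm (ciSup_le' fun n => (hlt _).le) ?_
    have h1 : (Set.univ : Set Δ) = ⋃ n : ULift.{u} ℕ, {δ | w δ ≤ 2 ^ n.down * b} := by
      refine (Set.eq_univ_of_forall fun δ => ?_).symm
      obtain ⟨n, hn⟩ := pow_unbounded_of_one_lt (w δ / b) (one_lt_two (α := ℝ))
      exact Set.mem_iUnion.2 ⟨⟨n⟩, (div_le_iff₀ hb).1 hn.le⟩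
    have h2 := Cardinal.mk_iUnion_le fun n : ULift.{u} ℕ => {δ | w δ ≤ 2 ^ n.down * b}
    rw [← h1, Cardinal.mk_univ, hΔ] at h2
    refine h2.trans ?_
    have h3 : ⨆ n : ULift.{u} ℕ, #{δ | w δ ≤ 2 ^ n.down * b} ≤ ⨆ n, #(Below w b n) :=
      ciSup_le' fun n => le_ciSup hbdd n.down
    refine (mul_le_mul' le_rfl h3).trans ?_
    have h4 : ℵ₀ ≤ ⨆ n, #(Below w b n) := (h 0).le.trans (le_ciSup hbdd 0)
    simp only [Cardinal.mk_uLift, Cardinal.mk_nat, Cardinal.lift_aleph0]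
    rw [Cardinal.aleph0_mul_eq h4]
  refine ⟨fun n => ?_, fun n => hsup ▸ hlt _, hsup⟩
  refine Cardinal.mk_subtype_le_of_subset fun δ hδ => le_trans hδ ?_
  gcongr
  · norm_num
  · omega

theorem isomorphic_split {Γ : Type u} {w : Γ → ℝ} (hw : ∀ γ, 0 < w γ) (s : Set Γ) :
    Isomorphic (WeakLp p w)
      ((WeakLp p fun x : (sᶜ : Set Γ) => w x) × WeakLp p fun x : s => w x) := by
  classical
  let e : (sᶜ : Set Γ) ⊕ s ≃ Γ := (Equiv.sumComm _ _).trans (Equiv.Set.sumCompl s)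
  have he : ∀ x, w (e x) = Sum.elim (fun x : (sᶜ : Set Γ) => w x) (fun x : s => w x) x := by
    rintro (x | x)
    · exact congrArg w (Equiv.Set.sumCompl_apply_inr s x)
    · exact congrArg w (Equiv.Set.sumCompl_apply_inl s x)
  refine Isomorphic.trans (Isomorphic.symm (isomorphic_of_equiv p
    (sum_elim_pos (fun x => hw _) fun x => hw _) hw e le_rfl (fun x => ?_) fun x => ?_))
    (isomorphic_sum p (fun x => hw _) fun x => hw _)
  · rw [one_mul]; exact (he x).le
  · rw [one_mul]; exact (he x).ge

theorem isomorphic_split_multiples {Γ : Type u} {w : Γ → ℝ} (hw : ∀ γ, 0 < w γ) (s : Set Γ) :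
    Isomorphic (WeakLp p fun x : Γ × ℕ => w x.1)
      ((WeakLp p fun x : (sᶜ : Set Γ) × ℕ => w x.1) × WeakLp p fun x : s × ℕ => w x.1) := by
  classical
  let e : (sᶜ : Set Γ) × ℕ ⊕ s × ℕ ≃ Γ × ℕ := (Equiv.sumProdDistrib _ _ _).symm.trans
    (Equiv.prodCongr ((Equiv.sumComm _ _).trans (Equiv.Set.sumCompl s)) (Equiv.refl ℕ))
  have he : ∀ x, w (e x).1 =
      Sum.elim (fun x : (sᶜ : Set Γ) × ℕ => w x.1) (fun x : s × ℕ => w x.1) x := by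
    rintro (x | x)
    · exact congrArg w (Equiv.Set.sumCompl_apply_inr s x.1)
    · exact congrArg w (Equiv.Set.sumCompl_apply_inl s x.1)
  refine Isomorphic.trans (Isomorphic.symm (isomorphic_of_equiv p
    (sum_elim_pos (fun x => hw _) fun x => hw _) (fun x => hw x.1) e le_rfl
      (fun x => ?_) fun x => ?_))
    (isomorphic_sum p (fun x => hw _) fun x => hw _)
  · rw [one_mul]; exact (he x).le
  · rw [one_mul]; exact (he x).ge

variable {p}

/-- Countably many atoms, even with multiplicity, fit complementably into Y, so s leaves no trace: Z
splits into two pieces, each complemented in Y, and Y ⊕ Y ≅ Y. -/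
theorem isomorphic_of_countable_low {Γ D : Type u} {w : Γ → ℝ} {y : D → ℝ} (hw : ∀ γ, 0 < w γ)
    (hy : ∀ d, 0 < y d) (hA : Ample y) [Nonempty D] (s : Set Γ) [Countable s]
    (h₁ : Retract (WeakLp p y) (WeakLp p fun x : (sᶜ : Set Γ) => w x))
    (h₂ : Retract (WeakLp p fun x : (sᶜ : Set Γ) × ℕ => w x.1) (WeakLp p y)) :
    Isomorphic (WeakLp p w) (WeakLp p y) := by
  have hsq := hA.isomorphic_prod_self p hy
  have h₃ : Retract (WeakLp p fun x : (sᶜ : Set Γ) => w x) (WeakLp p w) :=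
    retract_of_injective p (fun x => hw _) hw Subtype.val_injective le_rfl
      (fun x => by rw [one_mul]) (fun x => by rw [one_mul])
  have h₄ : Retract (WeakLp p fun x : s × ℕ => w x.1) (WeakLp p y) :=
    retract_of_countable p hy (fun x => hw x.1) hA
  exact isomorphic_of_retract hsq (isomorphic_prod_multiples p hw) (h₁.trans h₃)
    ((isomorphic_split_multiples p hw s).retract.trans ((h₂.prod h₄).trans hsq.retract))

/-- All sets of small atoms in s have full cardinality |s|, so s contains F(s) and its multiples fit
into F(s). The decomposition is then run with Y ⊕ F(s). -/
theorem isomorphic_of_uncountable_low {Γ D : Type u} {w : Γ → ℝ} {y : D → ℝ}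
    (hw : ∀ γ, 0 < w γ) (hy : ∀ d, 0 < y d) (hA : Ample y) (s : Set Γ) (hs : ℵ₀ < #s)
    (hlow : ∀ n : ℕ, #s ≤ #{x : s // w x ≤ (2 ^ n)⁻¹})
    (h₁ : Retract (WeakLp p y) (WeakLp p fun x : (sᶜ : Set Γ) => w x))
    (h₂ : Retract (WeakLp p fun x : (sᶜ : Set Γ) × ℕ => w x.1) (WeakLp p y)) :
    Isomorphic (WeakLp p w) (WeakLp p y × F p s) := by
  have : Infinite s := Cardinal.infinite_iff.2 hs.le
  have h₃ : Retract (F p s) (WeakLp p fun x : s => w x) := F_retract p (fun x => hw x) hs hlow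
  have h₄ : Retract (WeakLp p fun x : s × ℕ => w x.1) (F p s) :=
    retract_F p (w := fun x : s => w x) (fun x => hw x) le_rfl
  have h₅ : Isomorphic (F p s × F p s) (F p s) :=
    (ample_F s).isomorphic_prod_self p fun x => by positivity
  exact isomorphic_of_retract
    (Isomorphic.prod_prod_comm (hA.isomorphic_prod_self p hy) h₅) (isomorphic_prod_multiples p hw)
    ((h₁.prod h₃).trans (isomorphic_split p hw s).symm.retract)
    ((isomorphic_split_multiples p hw s).retract.trans (h₂.prod h₄))

end
end AtomicWeakLp

/-! ### The case distinction -/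

open AtomicWeakLp in
theorem mainTheorem3 {Γ : Type u} [Uncountable Γ] (p : ℝ) [Fact (1 < p)]
    (w : Γ → ℝ) (hw : ∀ γ, 0 < w γ) :
    AtomicWeakLp.Isomorphic (AtomicWeakLp.WeakLp p w) (AtomicWeakLp.L p Γ) ∨
    (∃ P : ℕ → Type u, AtomicWeakLp.Admissible Γ P ∧
      AtomicWeakLp.Isomorphic (AtomicWeakLp.WeakLp p w) (AtomicWeakLp.E p P)) ∨
    AtomicWeakLp.Isomorphic (AtomicWeakLp.WeakLp p w) (AtomicWeakLp.F p Γ) ∨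
    (∃ Q : Type u, ℵ₀ < #Q ∧ #Q < #Γ ∧
      AtomicWeakLp.Isomorphic (AtomicWeakLp.WeakLp p w)
        (AtomicWeakLp.L p Γ × AtomicWeakLp.F p Q)) ∨
    (∃ (P : ℕ → Type u) (Q : Type u), AtomicWeakLp.Admissible Γ P ∧ ℵ₀ < #Q ∧ #Q < #Γ ∧
      AtomicWeakLp.Isomorphic (AtomicWeakLp.WeakLp p w)
        (AtomicWeakLp.E p P × AtomicWeakLp.F p Q)) := by
  have hΓ : ℵ₀ < #Γ := Cardinal.aleph0_lt_mk
  let low : ℕ → Set Γ := fun n => {γ | w γ ≤ (2 ^ n)⁻¹}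
  have hanti : ∀ m n, m ≤ n → low n ⊆ low m := fun m n hmn γ hγ =>
    le_trans hγ (inv_anti₀ (by positivity : (0 : ℝ) < 2 ^ m) (pow_le_pow_right₀ one_le_two hmn))
  -- Cardinals are well-ordered, so the decreasing cardinalities of the sets of small atoms attain
  -- their minimum.
  obtain ⟨n₀, hn₀⟩ : ∃ n₀, ∀ n, #(low n₀) ≤ #(low n) := by
    obtain ⟨n₀, h⟩ := ciInf_mem fun n => #(low n)
    exact ⟨n₀, fun n => h.trans_le (ciInf_le' _ n)⟩
  rcases le_or_gt #Γ #(low n₀) with hbig | hsmall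
  · refine Or.inr (Or.inr (Or.inl ?_))
    exact isomorphic_of_retract ((ample_F Γ).isomorphic_prod_self p fun x => by positivity)
      (isomorphic_prod_multiples p hw) (F_retract p hw hΓ fun n => hbig.trans (hn₀ n))
      (retract_F p hw le_rfl)
  set s := low n₀ with hs
  have hcard : #(sᶜ : Set Γ) = #Γ := Cardinal.mk_compl_of_infinite s hsmall
  have ha : (0 : ℝ) < (2 ^ n₀)⁻¹ := by positivity
  have hwa : ∀ x : (sᶜ : Set Γ), (2 ^ n₀)⁻¹ < w x := fun x => not_le.1 x.2
  have hwc : ∀ x : (sᶜ : Set Γ), 0 < w x := fun x => hw x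
  -- Minimality of |s|, applied at max n n₀ so that the smaller set lies inside s.
  have hlow : ∀ n : ℕ, #s ≤ #{x : s // w x ≤ (2 ^ n)⁻¹} := by
    intro n
    refine (hn₀ (max n n₀)).trans (Cardinal.mk_le_of_injective
      (f := fun x => ⟨⟨x.1, hanti _ _ (le_max_right n n₀) x.2⟩,
        hanti _ _ (le_max_left n n₀) x.2⟩) fun x y hxy => ?_)
    simp only [Subtype.mk.injEq] at hxy
    exact Subtype.ext hxy
  -- Off s the masses are bounded below. Either |Γ| atoms have bounded mass, which gives L, or |Γ|
  -- is only approached as the bound grows, which gives E.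
  by_cases hL : ∃ b, #Γ ≤ #{x : (sᶜ : Set Γ) // w x ≤ b}
  · obtain ⟨b, hb⟩ := hL
    have h₁ := L_retract p hwc hΓ hb
    have h₂ := retract_L p (Γ := Γ) hwc hcard.le ha hwa
    rcases le_or_gt #s ℵ₀ with hc | hc
    · have : Countable s := Cardinal.mk_le_aleph0_iff.1 hc
      exact Or.inl (isomorphic_of_countable_low hw (fun _ => one_pos) (ample_const Γ) s h₁ h₂)
    · exact Or.inr (Or.inr (Or.inr (Or.inl ⟨s, hc, hsmall, isomorphic_of_uncountable_low hw
        (fun _ => one_pos) (ample_const Γ) s hc hlow h₁ h₂⟩)))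
  · push Not at hL
    -- Starting the levels at m makes all of them uncountable, hence the model E ample.
    obtain ⟨m, hm⟩ := exists_aleph0_lt_mk_le (fun x : (sᶜ : Set Γ) => w x) (hcard ▸ hΓ)
    have hm0 : (0 : ℝ) < m := by
      have : Nonempty {x : (sᶜ : Set Γ) // w x ≤ m} :=
        Cardinal.mk_ne_zero_iff.1 (Cardinal.aleph0_pos.trans hm).ne'
      obtain ⟨x⟩ := this
      exact (hwc x.1).trans_le x.2
    have hP : ∀ n, ℵ₀ < #(Below (fun x : (sᶜ : Set Γ) => w x) m n) := fun n =>
      hm.trans_le (Cardinal.mk_subtype_le_of_subset fun x hx => le_trans hx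
        (le_mul_of_one_le_left hm0.le (one_le_pow₀ one_le_two)))
    have hPi : ∀ n, Infinite (Below (fun x : (sᶜ : Set Γ) => w x) m n) := fun n =>
      Cardinal.infinite_iff.2 (hP n).le
    have hadm := admissible_below hcard hm0 hP hL
    have h₁ := E_retract p hwc hm0 hP
    have h₂ := retract_E p hwc hm0 hP ha hwa
    rcases le_or_gt #s ℵ₀ with hc | hc
    · have : Countable s := Cardinal.mk_le_aleph0_iff.1 hc
      exact Or.inr (Or.inl ⟨_, hadm, isomorphic_of_countable_low hw (fun x => by positivity)
        (ample_E _) s h₁ h₂⟩)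
    · exact Or.inr (Or.inr (Or.inr (Or.inr ⟨_, s, hadm, hc, hsmall,
        isomorphic_of_uncountable_low hw (fun x => by positivity) (ample_E _) s hc hlow h₁ h₂⟩)))
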